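/- All pairs $(X,\Gamma)$ below consist of a simplicial complex $X$ and a group $\Gamma$ of automorphisms of $X$ acting freely on (the geometric realization of) $X$, with finitely many orbits of simplices. A building of type $\tilde A_2$ is a simplicial complex that is a union of subcomplexes (apartments), each isomorphic to the tessellation of the plane by equilateral triangles, such that any two simplices lie in a common apartment, and such that for two apartments containing two given simplices there is an isomorphism between the apartments fixing both simplices pointwise (no thickness is required). An extension $\lambda:(X,\Gamma)\leadsto(X',\Gamma')$ of $(X,\Gamma)$ into a building of type $\tilde A_2$ with $n\ge 0$ chambers missing consists of a pair $(X',\Gamma')$ with $X'$ a building of type $\tilde A_2$, a simplicial map $\lambda:X\to X'$, and chambers $C_1,\dots,C_n$ of $X'$, pairwise inequivalent under $\Gamma'$, such that $\lambda(X)$ is the complement in $X'$ of $\Gamma'\mathring C_1\cup\dots\cup\Gamma'\mathring C_n$, and such that points $x,y\in X$ are in the same $\Gamma$-orbit if and only if $\lambda(x),\lambda(y)$ are in the same $\Gamma'$-orbit. **Theorem.** Let $(X,\Gamma)$ be a building of type $\tilde A_2$ with a single chamber missing; that is, $X$ is connected, homogeneous of dimension $2$ and without boundary (every edge lies in at least two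 triangles), and $(X,\Gamma)$ has an extension into a building of type $\tilde A_2$ with $n=1$ chamber missing. Then $(X,\Gamma)$ has a unique extension into a building of type $\tilde A_2$. Namely, such an extension exists, and for any two extensions $\lambda_0:(X,\Gamma)\leadsto(X_0',\Gamma_0')$ and $\lambda_1:(X,\Gamma)\leadsto(X_1',\Gamma_1')$ into buildings of type $\tilde A_2$, with any numbers of chambers missing, there is a simplicial isomorphism $\theta':X_0'\to X_1'$ with $\theta'\Gamma_0'\theta'^{-1}=\Gamma_1'$ and $\theta'\circ\lambda_0=\lambda_1$. -/

import Mathlib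

universe u v w z

namespace ChambersMissing

/-- The points of the geometric realization of an abstract simplicial complex, in barycentric
coordinates.  A vertex map `f` acts on points by `Finsupp.mapDomain f`, and the open simplex of a
face `s` consists of the points whose support is `s`. -/
def realization {V : Type u} (K : AbstractSimplicialComplex V) : Set (V →₀ ℝ) :=
  {p | p.support ∈ K.faces ∧ (∀ x, 0 ≤ p x) ∧ (p.sum fun _ t => t) = 1}

/-- The chambers of a simplicial complex are its maximal simplices. -/
def IsChamber {V : Type u} (K : AbstractSimplicialComplex V) (s : Finset V) : Prop :=
  s ∈ K.faces ∧ ∀ t ∈ K.faces, s ⊆ t → t = s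

/-- The 1-skeleton of a simplicial complex: distinct vertices are adjacent when they lie in a
common simplex. -/
def oneSkeleton {V : Type u} (K : AbstractSimplicialComplex V) : SimpleGraph V where
  Adj a b := a ≠ b ∧ ∃ s ∈ K.faces, a ∈ s ∧ b ∈ s
  symm := ⟨fun _ _ ⟨h, s, hs, ha, hb⟩ => ⟨h.symm, s, hs, hb, ha⟩⟩
  loopless := ⟨fun _ h => h.1 rfl⟩

/-- A (non-empty) connected simplicial complex. -/
def IsConnected {V : Type u} (K : AbstractSimplicialComplex V) : Prop :=
  (oneSkeleton K).Connected

/-- Homogeneous of dimension 2: there is no simplex of dimension more than 2, and every simplex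
lies in a triangle. -/
def IsHomogeneousOfDimTwo {V : Type u} (K : AbstractSimplicialComplex V) : Prop :=
  (∀ s ∈ K.faces, s.card ≤ 3) ∧ ∀ s ∈ K.faces, ∃ t ∈ K.faces, s ⊆ t ∧ t.card = 3

/-- A 2-dimensional complex has no boundary when it has no free edge: every edge lies in at least
two triangles. -/
def HasNoBoundary {V : Type u} (K : AbstractSimplicialComplex V) : Prop :=
  ∀ s ∈ K.faces, s.card = 2 →
    ∃ t ∈ K.faces, ∃ t' ∈ K.faces, t ≠ t' ∧ t.card = 3 ∧ t'.card = 3 ∧ s ⊆ t ∧ s ⊆ t'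

/-! ### Buildings of type `Ã₂` -/

/-- The six unit vectors of the triangular lattice, in a basis made of two unit vectors that form
an angle of 60 degrees. -/
def hexagonDirections : Set (ℤ × ℤ) :=
  {(1, 0), (0, 1), (-1, 1), (-1, 0), (0, -1), (1, -1)}

/-- The Coxeter complex of type `Ã₂`: the tessellation of the plane by equilateral triangles.  Its
simplices are the non-empty sets of pairwise neighbouring points of the triangular lattice. -/
def coxeterComplexTildeA2 : AbstractSimplicialComplex (ℤ × ℤ) where
  faces := {s | s.Nonempty ∧ ∀ a ∈ s, ∀ b ∈ s, a ≠ b → b - a ∈ hexagonDirections}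
  isRelLowerSet_faces := fun _ hs =>
    ⟨hs.1, fun _ hts ht => ⟨ht, fun a ha b hb hab => hs.2 a (hts ha) b (hts hb) hab⟩⟩
  singleton_mem := fun x => by
    refine ⟨Finset.singleton_nonempty x, ?_⟩
    intro a ha b hb hab
    exact absurd ((Finset.mem_singleton.1 ha).trans (Finset.mem_singleton.1 hb).symm) hab

open Classical in
/-- `f` is (the vertex map of) a simplicial isomorphism from the Coxeter complex of type `Ã₂` onto
the subcomplex with set of simplices `A`. -/
def IsChart {V : Type u} (f : ℤ × ℤ → V) (A : Set (Finset V)) : Prop :=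
  Function.Injective f ∧ A = {s | ∃ t ∈ coxeterComplexTildeA2.faces, s = t.image f}

/-- A simplicial complex is a building of type `Ã₂` if it is a union of subcomplexes, called
apartments, such that

* every apartment is isomorphic to the Coxeter complex of type `Ã₂`;
* any two simplices lie in a common apartment;
* if two apartments `A` and `A'` contain the simplices `s` and `t`, there is an isomorphism from
  `A` to `A'` that fixes `s` and `t` pointwise.

The isomorphism is written as `f' ∘ f⁻¹` with charts `f` of `A` and `f'` of `A'`. -/
def IsBuildingOfTypeTildeA2 {V : Type u} (K : AbstractSimplicialComplex V) : Prop :=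
  ∃ 𝒜 : Set (Set (Finset V)), 𝒜.Nonempty ∧
    (∀ A ∈ 𝒜, A ⊆ K.faces ∧ ∃ f, IsChart f A) ∧
    (∀ s ∈ K.faces, ∀ t ∈ K.faces, ∃ A ∈ 𝒜, s ∈ A ∧ t ∈ A) ∧
    ∀ A ∈ 𝒜, ∀ A' ∈ 𝒜, ∀ s t : Finset V, s ∈ A → t ∈ A → s ∈ A' → t ∈ A' →
      ∃ f f', IsChart f A ∧ IsChart f' A' ∧ ∀ x, f x ∈ s ∨ f x ∈ t → f' x = f x

/-! ### Extensions -/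

/-- A pair `(X, Γ)`: a simplicial complex `X` with a group `Γ` of automorphisms of `X` that acts
freely (on the geometric realization) with finite fundamental domain (there are finitely many
orbits of simplices). -/
structure Pair where
  Vert : Type u
  cplx : AbstractSimplicialComplex Vert
  grp : Subgroup (Equiv.Perm Vert)
  simplicial : ∀ γ ∈ grp, ∀ s ∈ cplx.faces, s.map γ.toEmbedding ∈ cplx.faces
  free : ∀ γ ∈ grp, ∀ p ∈ realization cplx, p.mapDomain γ = p → γ = 1
  finite_quotient : ∃ F : Set (Finset Vert), F.Finite ∧
    ∀ s ∈ cplx.faces, ∃ γ ∈ grp, s.map γ.toEmbedding ∈ F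

/-- Two points are in the same orbit of the group of the pair. -/
def Pair.SameOrbit (P : Pair.{u}) (p q : P.Vert →₀ ℝ) : Prop :=
  ∃ γ ∈ P.grp, p.mapDomain γ = q

/-- An extension `(X, Γ) ⤳ (X', Γ')` with missing chambers `C 1, …, C n` (up to `Γ'`). -/
structure Extension (P : Pair.{u}) (P' : Pair.{v}) where
  /-- the map `X → X'` on vertices -/
  toFun : P.Vert → P'.Vert
  /-- it is simplicial -/
  simplicial : open Classical in ∀ s ∈ P.cplx.faces, s.image toFun ∈ P'.cplx.faces
  /-- the number of missing chambers, up to `Γ'` -/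
  numMissing : ℕ
  /-- representatives of the missing chambers -/
  C : Fin numMissing → Finset P'.Vert
  isChamber : ∀ i, IsChamber P'.cplx (C i)
  /-- the missing chambers are pairwise inequivalent -/
  inequivalent : ∀ i j, i ≠ j → ∀ γ ∈ P'.grp, (C i).map γ.toEmbedding ≠ C j
  /-- the image of `X` does not meet the interior of a missing chamber -/
  missing : ∀ p ∈ realization P.cplx, ∀ i, ∀ γ ∈ P'.grp,
    (p.mapDomain toFun).support ≠ (C i).map γ.toEmbedding
  /-- every other point of `X'` is in the image of `X` -/
  covering : ∀ p' ∈ realization P'.cplx,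
    (∃ p ∈ realization P.cplx, p.mapDomain toFun = p') ∨
      ∃ i, ∃ γ ∈ P'.grp, p'.support = (C i).map γ.toEmbedding
  /-- points of `X` are equivalent under `Γ` iff their images are equivalent under `Γ'` -/
  orbits : ∀ p ∈ realization P.cplx, ∀ q ∈ realization P.cplx,
    P.SameOrbit p q ↔ P'.SameOrbit (p.mapDomain toFun) (q.mapDomain toFun)

/-- An equivariant isomorphism `(X, Γ) → (X₁, Γ₁)`: a simplicial isomorphism that conjugates `Γ`
to `Γ₁`. -/
structure PairIso (P : Pair.{u}) (P₁ : Pair.{v}) where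
  toEquiv : P.Vert ≃ P₁.Vert
  faces_iff : ∀ s, s ∈ P.cplx.faces ↔ s.map toEquiv.toEmbedding ∈ P₁.cplx.faces
  equivariant : ∀ γ : Equiv.Perm P.Vert, γ ∈ P.grp ↔ toEquiv.permCongr γ ∈ P₁.grp

/-- An isomorphism between two extensions: equivariant isomorphisms `θ` of the sources and `θ'` of
the targets which make the square commute. -/
structure ExtensionIso {P₀ : Pair.{u}} {P₀' : Pair.{v}} {P₁ : Pair.{w}} {P₁' : Pair.{z}}
    (e₀ : Extension P₀ P₀') (e₁ : Extension P₁ P₁') where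
  θ : PairIso P₀ P₁
  θ' : PairIso P₀' P₁'
  comm : ∀ x, θ'.toEquiv (e₀.toFun x) = e₁.toFun (θ.toEquiv x)

/-- `(X, Γ)` is a building of type `Ã₂` with `n` chambers missing (and without boundary): `X` is
connected, homogeneous of dimension 2 and without boundary, and `(X, Γ)` has an extension into a
building of type `Ã₂` with `n` missing chambers. -/
def IsBuildingOfTypeTildeA2WithChambersMissing (P : Pair.{u}) (n : ℕ) : Prop :=
  IsConnected P.cplx ∧ IsHomogeneousOfDimTwo P.cplx ∧ HasNoBoundary P.cplx ∧
    ∃ (P' : Pair.{u}) (e : Extension P P'),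
      IsBuildingOfTypeTildeA2 P'.cplx ∧ e.numMissing = n

end ChambersMissing

/-! Existence is part of the hypothesis. For uniqueness, the given extension `e`, which misses one
orbit of chambers, is compared with an arbitrary extension. Both fill the same corners of X and
identify the same vertices of X, and these data determine the target complex and its group
(`Compatible.exists_iso`). Two arbitrary extensions are then compared through `e`.

Local part. An extension is bijective on the neighbours of each vertex x. So the link of x in X is a
subgraph, on the same vertices, of the link in the building, which is the incidence graph of a
possibly degenerate projective plane. Since Γ' acts freely, each of the three vertices of the
missing chamber accounts for at most one missing edge, so at most three edges are missing; absence
of boundary gives every vertex degree at least two. Such a partial plane has only one completion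
(`IsNearlyFull.completion_unique`), so every other extension fills the same corners.

Around a chamber. The filled corners must also be assembled into triangles in the same way
(`SameCorners.sameMatching`). A different assembly would produce a second missing chamber sharing an
edge with the first. As there is a single missing orbit, a group element carries one to the other,
and freeness in the two buildings rules out every possible such element.

Global part. The pairs (λ₀ x, λ₁ x) form a connected graph covering the 1-skeleton of X₀', in which
triangles lift. A building is simply connected (`IsBuildingOfTypeTildeA2.injective_of_covering`), so
λ₀ x determines λ₁ x, and conversely by symmetry.

The facts about buildings all come from the retraction onto an apartment centered at a triangle. -/

namespace ChambersMissing

/-! ### The triangular lattice -/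

theorem mem_hexagonDirections {d : ℤ × ℤ} : d ∈ hexagonDirections ↔
    (d.1 = 1 ∧ d.2 = 0) ∨ (d.1 = 0 ∧ d.2 = 1) ∨ (d.1 = -1 ∧ d.2 = 1) ∨
    (d.1 = -1 ∧ d.2 = 0) ∨ (d.1 = 0 ∧ d.2 = -1) ∨ (d.1 = 1 ∧ d.2 = -1) := by
  simp [hexagonDirections, Prod.ext_iff]

/-- Neighbouring points of the triangular lattice. -/
def hexAdj (p q : ℤ × ℤ) : Prop := q - p ∈ hexagonDirections

theorem hexAdj_iff {p q : ℤ × ℤ} : hexAdj p q ↔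
    (q.1 - p.1 = 1 ∧ q.2 - p.2 = 0) ∨ (q.1 - p.1 = 0 ∧ q.2 - p.2 = 1) ∨
    (q.1 - p.1 = -1 ∧ q.2 - p.2 = 1) ∨ (q.1 - p.1 = -1 ∧ q.2 - p.2 = 0) ∨
    (q.1 - p.1 = 0 ∧ q.2 - p.2 = -1) ∨ (q.1 - p.1 = 1 ∧ q.2 - p.2 = -1) :=
  mem_hexagonDirections

theorem hexAdj.symm {p q : ℤ × ℤ} (h : hexAdj p q) : hexAdj q p := by
  rw [hexAdj_iff] at *; omega

theorem hexAdj.ne {p q : ℤ × ℤ} (h : hexAdj p q) : p ≠ q := by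
  rintro rfl; rw [hexAdj_iff] at h; omega

/-- The distance from the origin in the triangular lattice. -/
def hexNorm (d : ℤ × ℤ) : ℕ := max (max d.1.natAbs d.2.natAbs) (d.1 + d.2).natAbs

theorem hexNorm_zero : hexNorm 0 = 0 := rfl

theorem hexNorm_le_iff {d : ℤ × ℤ} {n : ℤ} : (hexNorm d : ℤ) ≤ n ↔ d.1 ≤ n ∧ -d.1 ≤ n ∧
    d.2 ≤ n ∧ -d.2 ≤ n ∧ d.1 + d.2 ≤ n ∧ -(d.1 + d.2) ≤ n := by
  unfold hexNorm; omega

theorem le_hexNorm (d : ℤ × ℤ) : d.1 ≤ (hexNorm d : ℤ) ∧ -d.1 ≤ (hexNorm d : ℤ) ∧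
    d.2 ≤ (hexNorm d : ℤ) ∧ -d.2 ≤ (hexNorm d : ℤ) ∧ d.1 + d.2 ≤ (hexNorm d : ℤ) ∧
    -(d.1 + d.2) ≤ (hexNorm d : ℤ) :=
  hexNorm_le_iff.1 le_rfl

theorem hexNorm_le_of_hexAdj {p q : ℤ × ℤ} (h : hexAdj p q) : hexNorm q ≤ hexNorm p + 1 := by
  rw [hexAdj_iff] at h
  have h1 := le_hexNorm p
  have : (hexNorm q : ℤ) ≤ hexNorm p + 1 := hexNorm_le_iff.2 (by omega)
  exact_mod_cast this

theorem eq_zero_of_hexNorm {p : ℤ × ℤ} (h : hexNorm p = 0) : p = 0 := by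
  have := le_hexNorm p
  ext <;> simp <;> omega

/-- The plane is cut into six half-open sectors, on each of which the distance is a single linear
form (the `n` of `key`). The neighbours closer to the origin are among the two steps back along the
sides of the sector. On a wall only `r₁` is closer, and `r₂` merely completes the triangle. -/
theorem exists_descending_triangle {q : ℤ × ℤ} (hq : q ≠ 0) :
    ∃ r₁ r₂, hexAdj q r₁ ∧ hexAdj q r₂ ∧ hexAdj r₁ r₂ ∧ hexNorm r₁ < hexNorm q ∧
      ∀ r, hexAdj q r → hexNorm r < hexNorm q → r = r₁ ∨ r = r₂ := by
  obtain ⟨a, b⟩ := q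
  have hq' : a ≠ 0 ∨ b ≠ 0 := by
    by_contra! h
    exact hq (Prod.ext h.1 h.2)
  have hN := le_hexNorm (a, b)
  simp only at hN
  have key : ∀ c d c' d' n : ℤ, hexAdj (a, b) (c, d) → hexAdj (a, b) (c', d') →
      hexAdj (c, d) (c', d') → (hexNorm (a, b) : ℤ) ≤ n → n ≤ hexNorm (a, b) →
      (hexNorm (c, d) : ℤ) ≤ n - 1 →
      (∀ x y, hexAdj (a, b) (x, y) → (hexNorm (x, y) : ℤ) ≤ n - 1 →
        (x = c ∧ y = d) ∨ (x = c' ∧ y = d')) →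
      ∃ r₁ r₂, hexAdj (a, b) r₁ ∧ hexAdj (a, b) r₂ ∧ hexAdj r₁ r₂ ∧
        hexNorm r₁ < hexNorm (a, b) ∧
        ∀ r, hexAdj (a, b) r → hexNorm r < hexNorm (a, b) → r = r₁ ∨ r = r₂ :=
    fun c d c' d' n h1 h2 h3 h4 h4' h5 h6 => ⟨(c, d), (c', d'), h1, h2, h3, by omega,
      fun r h h' => by simpa [Prod.ext_iff] using h6 r.1 r.2 h (by rw [Prod.mk.eta]; omega)⟩
  by_cases h1 : 0 < a ∧ 0 ≤ b
  · apply key (a - 1) b a (b - 1) (a + b) <;>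
      (try simp only [hexAdj_iff, hexNorm_le_iff]) <;> omega
  by_cases h2 : a ≤ 0 ∧ 0 < a + b
  · apply key a (b - 1) (a + 1) (b - 1) b <;>
      (try simp only [hexAdj_iff, hexNorm_le_iff]) <;> omega
  by_cases h3 : 0 < b ∧ a + b ≤ 0
  · apply key (a + 1) (b - 1) (a + 1) b (-a) <;>
      (try simp only [hexAdj_iff, hexNorm_le_iff]) <;> omega
  by_cases h4 : a < 0 ∧ b ≤ 0
  · apply key (a + 1) b a (b + 1) (-a - b) <;>
      (try simp only [hexAdj_iff, hexNorm_le_iff]) <;> omega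
  by_cases h5 : 0 ≤ a ∧ a + b < 0
  · apply key a (b + 1) (a - 1) (b + 1) (-b) <;>
      (try simp only [hexAdj_iff, hexNorm_le_iff]) <;> omega
  · apply key (a - 1) (b + 1) (a - 1) b a <;>
      (try simp only [hexAdj_iff, hexNorm_le_iff]) <;> omega

theorem hexNorm_eq (d : ℤ × ℤ) : (hexNorm d : ℤ) = d.1 ∨ (hexNorm d : ℤ) = -d.1 ∨
    (hexNorm d : ℤ) = d.2 ∨ (hexNorm d : ℤ) = -d.2 ∨ (hexNorm d : ℤ) = d.1 + d.2 ∨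
    (hexNorm d : ℤ) = -(d.1 + d.2) := by
  unfold hexNorm; omega

/-- Spheres are hexagons. An edge between two points of a sphere lies along a side, so its direction
tells which linear form, up to sign, gives the norm; the triangle on the inner side of the edge has
the required vertex. -/
theorem exists_common_descending {q q' : ℤ × ℤ} (h : hexAdj q q') (hn : hexNorm q = hexNorm q') :
    ∃ r, hexAdj q r ∧ hexAdj q' r ∧ hexNorm r < hexNorm q := by
  wlog hd : (q'.1 - q.1 = 1 ∧ q'.2 - q.2 = 0) ∨ (q'.1 - q.1 = 0 ∧ q'.2 - q.2 = 1) ∨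
    (q'.1 - q.1 = -1 ∧ q'.2 - q.2 = 1) generalizing q q'
  · have h' := h
    rw [hexAdj_iff] at h'
    obtain ⟨r, h1, h2, h3⟩ := this h.symm hn.symm (by omega)
    exact ⟨r, h2, h1, by omega⟩
  have hN := le_hexNorm q
  have hN' := le_hexNorm q'
  have hE := hexNorm_eq q
  have hE' := hexNorm_eq q'
  have key : ∀ c d : ℤ, hexAdj q (c, d) → hexAdj q' (c, d) →
      (hexNorm (c, d) : ℤ) ≤ hexNorm q - 1 →
      ∃ r, hexAdj q r ∧ hexAdj q' r ∧ hexNorm r < hexNorm q :=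
    fun c d h1 h2 h3 => ⟨(c, d), h1, h2, by omega⟩
  simp only [hexAdj_iff, hexNorm_le_iff] at key
  rw [← hn] at hN' hE'
  rcases hd with ⟨h1, h2⟩ | ⟨h1, h2⟩ | ⟨h1, h2⟩
  · have : (hexNorm q : ℤ) = q.2 ∨ (hexNorm q : ℤ) = -q.2 := by omega
    rcases this with h3 | h3
    · refine (key (q.1 + 1) (q.2 - 1) ?_ ?_ ?_).imp fun r hr => by rwa [hexAdj_iff, hexAdj_iff]
      all_goals omega
    · refine (key q.1 (q.2 + 1) ?_ ?_ ?_).imp fun r hr => by rwa [hexAdj_iff, hexAdj_iff]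
      all_goals omega
  · have : (hexNorm q : ℤ) = q.1 ∨ (hexNorm q : ℤ) = -q.1 := by omega
    rcases this with h3 | h3
    · refine (key (q.1 - 1) (q.2 + 1) ?_ ?_ ?_).imp fun r hr => by rwa [hexAdj_iff, hexAdj_iff]
      all_goals omega
    · refine (key (q.1 + 1) q.2 ?_ ?_ ?_).imp fun r hr => by rwa [hexAdj_iff, hexAdj_iff]
      all_goals omega
  · have : (hexNorm q : ℤ) = q.1 + q.2 ∨ (hexNorm q : ℤ) = -(q.1 + q.2) := by omega
    rcases this with h3 | h3
    · refine (key (q.1 - 1) q.2 ?_ ?_ ?_).imp fun r hr => by rwa [hexAdj_iff, hexAdj_iff]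
      all_goals omega
    · refine (key q.1 (q.2 + 1) ?_ ?_ ?_).imp fun r hr => by rwa [hexAdj_iff, hexAdj_iff]
      all_goals omega

/-- Rotation by 60 degrees. -/
def hexTurn (d : ℤ × ℤ) : ℤ × ℤ := (-d.2, d.1 + d.2)

/-- Rotation by 60 degrees about `p`. -/
def hexRot (p q : ℤ × ℤ) : ℤ × ℤ := p + hexTurn (q - p)

theorem hexRot_add (p d : ℤ × ℤ) : hexRot p (p + d) = p + hexTurn d := by simp [hexRot]

theorem hexAdj_add_right {p d : ℤ × ℤ} : hexAdj p (p + d) ↔ d ∈ hexagonDirections := by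
  simp [hexAdj]

theorem hexAdj_add_add {p d e : ℤ × ℤ} : hexAdj (p + d) (p + e) ↔ e - d ∈ hexagonDirections := by
  simp [hexAdj]

/-- The hexagon as a finite set. -/
def hexagon : Finset (ℤ × ℤ) := {(1, 0), (0, 1), (-1, 1), (-1, 0), (0, -1), (1, -1)}

theorem mem_hexagon {d : ℤ × ℤ} : d ∈ hexagonDirections ↔ d ∈ hexagon := by
  simp [hexagonDirections, hexagon]

theorem exists_eq_add (p q : ℤ × ℤ) : ∃ d, q = p + d := ⟨q - p, by simp⟩

theorem hexAdj_hexRot {p q : ℤ × ℤ} (h : hexAdj p q) :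
    hexAdj p (hexRot p q) ∧ hexAdj q (hexRot p q) := by
  obtain ⟨d, rfl⟩ := exists_eq_add p q
  rw [hexRot_add, hexAdj_add_right, hexAdj_add_add, mem_hexagon, mem_hexagon]
  rw [hexAdj_add_right, mem_hexagon] at h
  revert d
  decide

/-- An edge lies in exactly two triangles, so of two distinct third vertices one is on the rotated
side. -/
theorem eq_hexRot_of_hexAdj {p q r r' : ℤ × ℤ} (hq : hexAdj p q) (hr : hexAdj p r)
    (hqr : hexAdj q r) (hr' : hexAdj p r') (hqr' : hexAdj q r') (h : r ≠ r') :
    r = hexRot p q ∨ r' = hexRot p q := by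
  obtain ⟨d, rfl⟩ := exists_eq_add p q
  obtain ⟨e, rfl⟩ := exists_eq_add p r
  obtain ⟨e', rfl⟩ := exists_eq_add p r'
  simp only [hexRot_add, hexAdj_add_right, hexAdj_add_add, mem_hexagon, add_right_inj, ne_eq] at *
  have key : ∀ d ∈ hexagon, ∀ e ∈ hexagon, e - d ∈ hexagon → ∀ e' ∈ hexagon, e' - d ∈ hexagon →
      e ≠ e' → e = hexTurn d ∨ e' = hexTurn d := by decide
  exact key d hq e hr hqr e' hr' hqr' h

/-- The other corners of a hexagon, as seen from one corner. -/
theorem eq_iterate_hexRot {p q r : ℤ × ℤ} (hq : hexAdj p q) (hr : hexAdj p r) :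
    r = q ∨ r = hexRot p q ∨ r = hexRot p (hexRot p q) ∨ r = hexRot p (hexRot p (hexRot p q)) ∨
      q = hexRot p (hexRot p r) ∨ q = hexRot p r := by
  obtain ⟨d, rfl⟩ := exists_eq_add p q
  obtain ⟨e, rfl⟩ := exists_eq_add p r
  simp only [hexRot_add, hexAdj_add_right, mem_hexagon, add_right_inj] at *
  revert e
  revert d
  decide

theorem eq_hexRot_of_hexAdj_three {p q r : ℤ × ℤ} (hq : hexAdj p q) (hr : hexAdj p r)
    (hqr : hexAdj q r) (hr' : hexAdj (hexRot p (hexRot p q)) r) : r = hexRot p q := by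
  obtain ⟨d, rfl⟩ := exists_eq_add p q
  obtain ⟨e, rfl⟩ := exists_eq_add p r
  simp only [hexRot_add, hexAdj_add_right, hexAdj_add_add, mem_hexagon, add_right_inj] at *
  have key : ∀ d ∈ hexagon, ∀ e ∈ hexagon, e - d ∈ hexagon → e - hexTurn (hexTurn d) ∈ hexagon →
      e = hexTurn d := by decide
  exact key d hq e hr hqr hr'

theorem eq_iterate_hexRot_six {p q r : ℤ × ℤ} (hq : hexAdj p q) (hr : hexAdj p r) :
    r = q ∨ r = hexRot p q ∨ r = hexRot p (hexRot p q) ∨ r = hexRot p (hexRot p (hexRot p q)) ∨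
      r = hexRot p (hexRot p (hexRot p (hexRot p q))) ∨
      r = hexRot p (hexRot p (hexRot p (hexRot p (hexRot p q)))) := by
  obtain ⟨d, rfl⟩ := exists_eq_add p q
  obtain ⟨e, rfl⟩ := exists_eq_add p r
  simp only [hexRot_add, hexAdj_add_right, mem_hexagon, add_right_inj] at *
  revert e
  revert d
  decide

theorem hex_connected {S : ℤ × ℤ → Prop} {p : ℤ × ℤ} (hp : S p)
    (hS : ∀ q r, S q → hexAdj q r → S r) (q : ℤ × ℤ) : S q := by
  have key : ∀ n, ∀ q : ℤ × ℤ, hexNorm (q - p) = n → S q := by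
    intro n
    induction n with
    | zero =>
      intro q hq
      have := sub_eq_zero.1 (eq_zero_of_hexNorm hq)
      rwa [this]
    | succ n ih =>
      intro q hq
      have h0 : q - p ≠ 0 := fun h => by rw [h, hexNorm_zero] at hq; omega
      obtain ⟨r, _, hr, _, _, hrn, _⟩ := exists_descending_triangle h0
      have h1 := hexNorm_le_of_hexAdj hr.symm
      have h2 : hexAdj (r + p) q := by
        have := hr.symm
        unfold hexAdj at *
        rwa [sub_add_eq_sub_sub_swap]
      exact hS _ _ (ih (r + p) (by rw [add_sub_cancel_right]; omega)) h2
  exact key _ q rfl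

/-- Each edge lies in two triangles. If the edge and one third vertex are fixed, injectivity forces
the other third vertex to be fixed too. This propagates around a hexagon, then to the whole lattice
by connectedness. -/
theorem hex_rigid {α : ℤ × ℤ → ℤ × ℤ} (hα : Function.Injective α)
    (hadj : ∀ x y, hexAdj x y → hexAdj (α x) (α y)) {p q r : ℤ × ℤ} (hpq : hexAdj p q)
    (hpr : hexAdj p r) (hqr : hexAdj q r) (hp : α p = p) (hq : α q = q) (hr : α r = r)
    (x : ℤ × ℤ) : α x = x := by
  have step : ∀ p q, hexAdj p q → α p = p → α q = q →
      (∃ r, hexAdj p r ∧ hexAdj q r ∧ α r = r) → α (hexRot p q) = hexRot p q := by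
    rintro p q hpq hp hq ⟨r, hpr, hqr, hr⟩
    by_contra hne
    have h1 := hexAdj_hexRot hpq
    have h2 := hadj _ _ h1.1
    have h3 := hadj _ _ h1.2
    rw [hp] at h2
    rw [hq] at h3
    have h4 : r ≠ α (hexRot p q) := fun h => by
      have h5 := hα (hr.trans h)
      exact hne (by rw [← h5, hr])
    rcases eq_hexRot_of_hexAdj hpq hpr hqr h2 h3 h4 with h | h
    · exact hne (by rw [← h, hr])
    · exact hne h
  have around : ∀ p q r, hexAdj p q → hexAdj p r → hexAdj q r → α p = p → α q = q → α r = r →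
      ∀ y, hexAdj p y → α y = y := by
    intro p q r hpq hpr hqr hp hq hr y hy
    have a1 := hexAdj_hexRot hpq
    have f1 := step p q hpq hp hq ⟨r, hpr, hqr, hr⟩
    have a2 := hexAdj_hexRot a1.1
    have f2 := step p _ a1.1 hp f1 ⟨q, hpq, a1.2.symm, hq⟩
    have a3 := hexAdj_hexRot a2.1
    have f3 := step p _ a2.1 hp f2 ⟨_, a1.1, a2.2.symm, f1⟩
    have a4 := hexAdj_hexRot a3.1
    have f4 := step p _ a3.1 hp f3 ⟨_, a2.1, a3.2.symm, f2⟩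
    have f5 := step p _ a4.1 hp f4 ⟨_, a3.1, a4.2.symm, f3⟩
    rcases eq_iterate_hexRot_six hpq hy with h | h | h | h | h | h <;> rw [h] <;> assumption
  have main : ∀ x, α x = x ∧ ∀ y, hexAdj x y → α y = y := by
    apply hex_connected (S := fun x => α x = x ∧ ∀ y, hexAdj x y → α y = y) (p := p)
      ⟨hp, around p q r hpq hpr hqr hp hq hr⟩
    rintro x y ⟨hx, hn⟩ hxy
    have h := hexAdj_hexRot hxy
    exact ⟨hn y hxy, around y x _ hxy.symm h.2 h.1 (hn y hxy) hx (hn _ h.1)⟩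
  exact (main x).1

/-! ### Edges and triangles of a simplicial complex -/

section Complex

variable {V : Type u} {K : AbstractSimplicialComplex V}

/-- Three distinct vertices of a common simplex. -/
def Tri (K : AbstractSimplicialComplex V) (a b c : V) : Prop :=
  a ≠ b ∧ a ≠ c ∧ b ≠ c ∧ ∃ s ∈ K.faces, a ∈ s ∧ b ∈ s ∧ c ∈ s

theorem Tri.swap {a b c : V} (h : Tri K a b c) : Tri K a c b :=
  let ⟨h1, h2, h3, s, hs, ha, hb, hc⟩ := h
  ⟨h2, h1, h3.symm, s, hs, ha, hc, hb⟩

theorem Tri.rotate {a b c : V} (h : Tri K a b c) : Tri K b c a :=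
  let ⟨h1, h2, h3, s, hs, ha, hb, hc⟩ := h
  ⟨h3, h1.symm, h2.symm, s, hs, hb, hc, ha⟩

theorem Tri.adj {a b c : V} (h : Tri K a b c) : (oneSkeleton K).Adj a b :=
  let ⟨h1, _, _, s, hs, ha, hb, _⟩ := h
  ⟨h1, s, hs, ha, hb⟩

open Classical in
theorem subset_mem_faces {s t : Finset V} (hs : s ∈ K.faces) (h : t ⊆ s) (ht : t.Nonempty) :
    t ∈ K.faces :=
  (K.isRelLowerSet_faces hs).2 h ht

open Classical in
theorem adj_iff {a b : V} : (oneSkeleton K).Adj a b ↔ a ≠ b ∧ {a, b} ∈ K.faces := by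
  constructor
  · rintro ⟨h, s, hs, ha, hb⟩
    exact ⟨h, subset_mem_faces hs (by simp [Finset.insert_subset_iff, ha, hb]) (by simp)⟩
  · rintro ⟨h, hs⟩
    exact ⟨h, _, hs, by simp, by simp⟩

open Classical in
theorem tri_iff {a b c : V} : Tri K a b c ↔ a ≠ b ∧ a ≠ c ∧ b ≠ c ∧ {a, b, c} ∈ K.faces := by
  constructor
  · rintro ⟨h1, h2, h3, s, hs, ha, hb, hc⟩
    exact ⟨h1, h2, h3, subset_mem_faces hs (by simp [Finset.insert_subset_iff, ha, hb, hc])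
      (by simp)⟩
  · rintro ⟨h1, h2, h3, hs⟩
    exact ⟨h1, h2, h3, _, hs, by simp, by simp, by simp⟩

end Complex

/-! ### Charts of apartments and their rigidity -/

section Charts

variable {V : Type u} {f g : ℤ × ℤ → V} {A : Set (Finset V)}

theorem mem_coxeter {s : Finset (ℤ × ℤ)} : s ∈ coxeterComplexTildeA2.faces ↔
    s.Nonempty ∧ ∀ a ∈ s, ∀ b ∈ s, a ≠ b → hexAdj a b := Iff.rfl

theorem pair_mem_coxeter {p q : ℤ × ℤ} (h : hexAdj p q) :
    ({p, q} : Finset (ℤ × ℤ)) ∈ coxeterComplexTildeA2.faces := by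
  refine mem_coxeter.2 ⟨by simp, ?_⟩
  have := h.symm
  simp only [Finset.mem_insert, Finset.mem_singleton]
  rintro a (rfl | rfl) b (rfl | rfl) hab <;> first | assumption | exact absurd rfl hab

theorem triple_mem_coxeter {p q r : ℤ × ℤ} (h : hexAdj p q) (h' : hexAdj p r) (h'' : hexAdj q r) :
    ({p, q, r} : Finset (ℤ × ℤ)) ∈ coxeterComplexTildeA2.faces := by
  refine mem_coxeter.2 ⟨by simp, ?_⟩
  have := h.symm
  have := h'.symm
  have := h''.symm
  simp only [Finset.mem_insert, Finset.mem_singleton]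
  rintro a (rfl | rfl | rfl) b (rfl | rfl | rfl) hab <;> first | assumption | exact absurd rfl hab

theorem singleton_mem_coxeter (p : ℤ × ℤ) :
    ({p} : Finset (ℤ × ℤ)) ∈ coxeterComplexTildeA2.faces :=
  coxeterComplexTildeA2.singleton_mem p

/-- Every simplex of the triangular tessellation lies in a triangle. -/
theorem exists_triple_of_mem_coxeter {s : Finset (ℤ × ℤ)} (hs : s ∈ coxeterComplexTildeA2.faces) :
    ∃ p q r, hexAdj p q ∧ hexAdj p r ∧ hexAdj q r ∧ s ⊆ {p, q, r} := by
  obtain ⟨⟨p, hp⟩, h⟩ := mem_coxeter.1 hs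
  by_cases h1 : ∃ q ∈ s, q ≠ p
  · obtain ⟨q, hq, hqp⟩ := h1
    have hpq := h p hp q hq hqp.symm
    by_cases h2 : ∃ r ∈ s, r ≠ p ∧ r ≠ q
    · obtain ⟨r, hr, hrp, hrq⟩ := h2
      have hpr := h p hp r hr hrp.symm
      have hqr := h q hq r hr hrq.symm
      refine ⟨p, q, r, hpq, hpr, hqr, fun x hx => ?_⟩
      by_contra hne
      simp only [Finset.mem_insert, Finset.mem_singleton, not_or] at hne
      have hpx := h p hp x hx (Ne.symm hne.1)
      have hqx := h q hq x hx (Ne.symm hne.2.1)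
      have hrx := h r hr x hx (Ne.symm hne.2.2)
      obtain ⟨d, rfl⟩ := exists_eq_add p q
      obtain ⟨e, rfl⟩ := exists_eq_add p r
      obtain ⟨e', rfl⟩ := exists_eq_add p x
      simp only [hexAdj_add_right, hexAdj_add_add, mem_hexagon] at *
      have key : ∀ d ∈ hexagon, ∀ e ∈ hexagon, e - d ∈ hexagon → ∀ e' ∈ hexagon,
          e' - d ∈ hexagon → e' - e ∉ hexagon := by decide
      exact key d hpq e hpr hqr e' hpx hqx hrx
    · push Not at h2
      have h3 := hexAdj_hexRot hpq
      refine ⟨p, q, hexRot p q, hpq, h3.1, h3.2, fun x hx => ?_⟩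
      have := h2 x hx
      simp only [Finset.mem_insert, Finset.mem_singleton]
      tauto
  · push Not at h1
    have hpq : hexAdj p (p + (1, 0)) := by simp [hexAdj, hexagonDirections]
    have h3 := hexAdj_hexRot hpq
    refine ⟨p, _, _, hpq, h3.1, h3.2, fun x hx => ?_⟩
    simp [h1 x hx]

open Classical in
theorem IsChart.image_mem (hf : IsChart f A) {s : Finset (ℤ × ℤ)}
    (hs : s ∈ coxeterComplexTildeA2.faces) : s.image f ∈ A := by
  rw [hf.2]; exact ⟨s, hs, rfl⟩

open Classical in
theorem IsChart.exists_preimage (hf : IsChart f A) {s : Finset V} (hs : s ∈ A) :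
    ∃ t ∈ coxeterComplexTildeA2.faces, s = t.image f := by
  rwa [hf.2] at hs

theorem IsChart.exists_eq (hf : IsChart f A) {s : Finset V} (hs : s ∈ A) {x : V} (hx : x ∈ s) :
    ∃ p, f p = x := by
  classical
  obtain ⟨t, -, rfl⟩ := hf.exists_preimage hs
  obtain ⟨p, -, rfl⟩ := Finset.mem_image.1 hx
  exact ⟨p, rfl⟩

theorem IsChart.hexAdj (hf : IsChart f A) {s : Finset V} (hs : s ∈ A) {p q : ℤ × ℤ} (hpq : p ≠ q)
    (hp : f p ∈ s) (hq : f q ∈ s) : hexAdj p q := by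
  classical
  obtain ⟨t, ht, rfl⟩ := hf.exists_preimage hs
  rw [Finset.mem_image] at hp hq
  obtain ⟨p', hp', h1⟩ := hp
  obtain ⟨q', hq', h2⟩ := hq
  rw [hf.1 h1] at hp'
  rw [hf.1 h2] at hq'
  exact (mem_coxeter.1 ht).2 p hp' q hq' hpq

theorem IsChart.exists_comparison (hf : IsChart f A) (hg : IsChart g A) :
    ∃ α : ℤ × ℤ ≃ ℤ × ℤ, (∀ x, g (α x) = f x) ∧ ∀ x y, ChambersMissing.hexAdj x y ↔
      ChambersMissing.hexAdj (α x) (α y) := by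
  classical
  have h : ∀ {f g : ℤ × ℤ → V}, IsChart f A → IsChart g A → ∀ x, ∃ y, g y = f x := by
    intro f g hf hg x
    exact hg.exists_eq (hf.image_mem (singleton_mem_coxeter x)) (by simp)
  choose a ha using h hf hg
  choose b hb using h hg hf
  refine ⟨⟨a, b, fun x => hf.1 (by rw [hb, ha]), fun x => hg.1 (by rw [ha, hb])⟩, ha, fun x y => ?_⟩
  show _ ↔ ChambersMissing.hexAdj (a x) (a y)
  constructor
  · intro hxy
    refine hg.hexAdj (hf.image_mem (pair_mem_coxeter hxy)) (fun h => ?_) (by simp [ha])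
      (by simp [ha])
    have := ha x
    rw [h, ha] at this
    exact hxy.ne (hf.1 this.symm)
  · intro hxy
    refine hf.hexAdj (hg.image_mem (pair_mem_coxeter hxy)) (fun h => ?_) (by simp [ha])
      (by simp [ha])
    rw [h] at hxy
    exact hxy.ne rfl

open Classical in
theorem IsChart.comp_equiv (hf : IsChart f A) (α : ℤ × ℤ ≃ ℤ × ℤ)
    (hα : ∀ x y, ChambersMissing.hexAdj x y ↔ ChambersMissing.hexAdj (α x) (α y)) :
    IsChart (f ∘ α) A := by
  have hmem : ∀ s : Finset (ℤ × ℤ), s ∈ coxeterComplexTildeA2.faces ↔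
      s.image α ∈ coxeterComplexTildeA2.faces := by
    intro s
    simp only [mem_coxeter, Finset.image_nonempty, Finset.forall_mem_image]
    simp only [← hα, ne_eq, EmbeddingLike.apply_eq_iff_eq]
  refine ⟨hf.1.comp α.injective, ?_⟩
  ext s
  rw [hf.2]
  constructor
  · rintro ⟨t, ht, rfl⟩
    have h : (t.image α.symm).image α = t := by simp [Finset.image_image]
    refine ⟨t.image α.symm, (hmem _).2 (by rwa [h]), ?_⟩
    rw [← Finset.image_image, h]
  · rintro ⟨t, ht, rfl⟩
    exact ⟨t.image α, (hmem t).1 ht, Finset.image_image.symm⟩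

/-- Two charts of an apartment which agree on a triangle are equal. -/
theorem IsChart.eq_of_eq_on_triangle (hf : IsChart f A) (hg : IsChart g A) {p q r : ℤ × ℤ}
    (hpq : ChambersMissing.hexAdj p q) (hpr : ChambersMissing.hexAdj p r)
    (hqr : ChambersMissing.hexAdj q r) (hp : f p = g p) (hq : f q = g q) (hr : f r = g r) :
    f = g := by
  obtain ⟨α, h1, h2⟩ := hf.exists_comparison hg
  funext x
  rw [← h1 x, hex_rigid α.injective (fun x y => (h2 x y).1) hpq hpr hqr
    (hg.1 ((h1 p).trans hp)) (hg.1 ((h1 q).trans hq)) (hg.1 ((h1 r).trans hr))]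

end Charts

/-! ### Apartment systems and retractions -/

/-- The apartments of a building of type `Ã₂`. -/
def IsApartmentSystem {V : Type u} (K : AbstractSimplicialComplex V)
    (𝒜 : Set (Set (Finset V))) : Prop :=
  (∀ A ∈ 𝒜, A ⊆ K.faces ∧ ∃ f, IsChart f A) ∧
    (∀ s ∈ K.faces, ∀ t ∈ K.faces, ∃ A ∈ 𝒜, s ∈ A ∧ t ∈ A) ∧
    ∀ A ∈ 𝒜, ∀ A' ∈ 𝒜, ∀ s t : Finset V, s ∈ A → t ∈ A → s ∈ A' → t ∈ A' →
      ∃ f f', IsChart f A ∧ IsChart f' A' ∧ ∀ x, f x ∈ s ∨ f x ∈ t → f' x = f x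

section Building

variable {V : Type u} {K : AbstractSimplicialComplex V} {𝒜 : Set (Set (Finset V))}

/-- The axiom supplies some chart of `A`; correcting by the automorphism of the tessellation that
compares it with `f` allows the chart of `A` to be prescribed. -/
theorem IsApartmentSystem.exists_chart_eq (h𝒜 : IsApartmentSystem K 𝒜) {A A' : Set (Finset V)}
    (hA : A ∈ 𝒜) (hA' : A' ∈ 𝒜) {f : ℤ × ℤ → V} (hf : IsChart f A) {s t : Finset V}
    (hs : s ∈ A) (ht : t ∈ A) (hs' : s ∈ A') (ht' : t ∈ A') :
    ∃ f', IsChart f' A' ∧ ∀ x, f x ∈ s ∨ f x ∈ t → f' x = f x := by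
  obtain ⟨f₁, f₂, h₁, h₂, h⟩ := h𝒜.2.2 A hA A' hA' s t hs ht hs' ht'
  obtain ⟨α, hα, hadj⟩ := hf.exists_comparison h₁
  refine ⟨f₂ ∘ α, h₂.comp_equiv α hadj, fun x hx => ?_⟩
  rw [← hα] at hx ⊢
  exact h _ hx

theorem IsApartmentSystem.adj_chart (h𝒜 : IsApartmentSystem K 𝒜) {A : Set (Finset V)} (hA : A ∈ 𝒜)
    {f : ℤ × ℤ → V} (hf : IsChart f A) {p q : ℤ × ℤ} (h : hexAdj p q) :
    (oneSkeleton K).Adj (f p) (f q) := by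
  classical
  exact ⟨fun h' => h.ne (hf.1 h'), _, (h𝒜.1 A hA).1 (hf.image_mem (pair_mem_coxeter h)),
    by simp, by simp⟩

theorem IsApartmentSystem.tri_chart (h𝒜 : IsApartmentSystem K 𝒜) {A : Set (Finset V)} (hA : A ∈ 𝒜)
    {f : ℤ × ℤ → V} (hf : IsChart f A) {p q r : ℤ × ℤ} (hpq : hexAdj p q) (hpr : hexAdj p r)
    (hqr : hexAdj q r) : Tri K (f p) (f q) (f r) := by
  classical
  exact ⟨fun h' => hpq.ne (hf.1 h'), fun h' => hpr.ne (hf.1 h'), fun h' => hqr.ne (hf.1 h'),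
    _, (h𝒜.1 A hA).1 (hf.image_mem (triple_mem_coxeter hpq hpr hqr)), by simp, by simp, by simp⟩

/-- The retraction of a building onto an apartment, centered at a triangle. -/
theorem IsApartmentSystem.exists_retraction (h𝒜 : IsApartmentSystem K 𝒜) {A : Set (Finset V)}
    (hA : A ∈ 𝒜) {f : ℤ × ℤ → V} (hf : IsChart f A) {p q r : ℤ × ℤ} (hpq : hexAdj p q)
    (hpr : hexAdj p r) (hqr : hexAdj q r) :
    ∃ σ : V → ℤ × ℤ, (∀ x, σ (f x) = x) ∧
      (∀ y z, (oneSkeleton K).Adj y z → hexAdj (σ y) (σ z)) ∧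
      ∀ z, σ z = p ∨ σ z = q ∨ σ z = r → z = f (σ z) := by
  classical
  have hE : ({p, q, r} : Finset (ℤ × ℤ)).image f ∈ A :=
    hf.image_mem (triple_mem_coxeter hpq hpr hqr)
  have exists_chart : ∀ s ∈ K.faces, ∃ A₁ ∈ 𝒜, ∃ g, IsChart g A₁ ∧ s ∈ A₁ ∧
      ({p, q, r} : Finset (ℤ × ℤ)).image f ∈ A₁ ∧ g p = f p ∧ g q = f q ∧ g r = f r := by
    intro s hs
    obtain ⟨A₁, hA₁, hE₁, hs₁⟩ := h𝒜.2.1 _ ((h𝒜.1 A hA).1 hE) s hs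
    obtain ⟨g, hg, h⟩ := h𝒜.exists_chart_eq hA hA₁ hf hE hE hE₁ hE₁
    exact ⟨A₁, hA₁, g, hg, hs₁, hE₁, h p (by simp), h q (by simp), h r (by simp)⟩
  -- The coordinates of a vertex do not depend on the apartment through the central triangle. The
  -- axiom gives a chart of `A₂` agreeing with `g₁` on that triangle and at the vertex, and by
  -- rigidity this chart is `g₂`. Hence `σ` below is well defined.
  have unique : ∀ A₁ ∈ 𝒜, ∀ A₂ ∈ 𝒜, ∀ g₁ g₂, IsChart g₁ A₁ → IsChart g₂ A₂ →
      ({p, q, r} : Finset (ℤ × ℤ)).image f ∈ A₁ → ({p, q, r} : Finset (ℤ × ℤ)).image f ∈ A₂ →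
      (g₁ p = f p ∧ g₁ q = f q ∧ g₁ r = f r) → (g₂ p = f p ∧ g₂ q = f q ∧ g₂ r = f r) →
      ∀ x y, g₁ x = g₂ y → x = y := by
    intro A₁ hA₁ A₂ hA₂ g₁ g₂ hg₁ hg₂ hE₁ hE₂ h₁ h₂ x y hxy
    have hx : {g₁ x} ∈ A₁ := by simpa using hg₁.image_mem (singleton_mem_coxeter x)
    have hx' : {g₁ x} ∈ A₂ := by simpa [hxy] using hg₂.image_mem (singleton_mem_coxeter y)
    obtain ⟨g, hg, h⟩ := h𝒜.exists_chart_eq hA₁ hA₂ hg₁ hE₁ hx hE₂ hx'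
    have hgg : g = g₂ := hg.eq_of_eq_on_triangle hg₂ hpq hpr hqr
      (by rw [h p (by simp [h₁]), h₁.1, h₂.1]) (by rw [h q (by simp [h₁]), h₁.2.1, h₂.2.1])
      (by rw [h r (by simp [h₁]), h₁.2.2, h₂.2.2])
    have := h x (by simp)
    rw [hgg, hxy] at this
    exact hg₂.1 this
  have exists_point : ∀ z, ∃ x, ∃ A₁ ∈ 𝒜, ∃ g, IsChart g A₁ ∧
      ({p, q, r} : Finset (ℤ × ℤ)).image f ∈ A₁ ∧ (g p = f p ∧ g q = f q ∧ g r = f r) ∧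
      g x = z := by
    intro z
    obtain ⟨A₁, hA₁, g, hg, hz, hE₁, h⟩ := exists_chart {z} (K.singleton_mem z)
    obtain ⟨x, hx⟩ := hg.exists_eq hz (Finset.mem_singleton_self z)
    exact ⟨x, A₁, hA₁, g, hg, hE₁, h, hx⟩
  choose σ hσ using exists_point
  have hσ_eq : ∀ A₁ ∈ 𝒜, ∀ g, IsChart g A₁ → ({p, q, r} : Finset (ℤ × ℤ)).image f ∈ A₁ →
      (g p = f p ∧ g q = f q ∧ g r = f r) → ∀ x, σ (g x) = x := by
    intro A₁ hA₁ g hg hE₁ h x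
    obtain ⟨A₂, hA₂, g₂, hg₂, hE₂, h₂, hx⟩ := hσ (g x)
    exact unique A₂ hA₂ A₁ hA₁ g₂ g hg₂ hg hE₂ hE₁ h₂ h _ _ hx
  refine ⟨σ, hσ_eq A hA f hf hE ⟨rfl, rfl, rfl⟩, ?_, ?_⟩
  · rintro y z ⟨hyz, s, hs, hy, hz⟩
    obtain ⟨A₁, hA₁, g, hg, hs₁, hE₁, h⟩ := exists_chart s hs
    obtain ⟨x, rfl⟩ := hg.exists_eq hs₁ hy
    obtain ⟨x', rfl⟩ := hg.exists_eq hs₁ hz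
    rw [hσ_eq A₁ hA₁ g hg hE₁ h, hσ_eq A₁ hA₁ g hg hE₁ h]
    exact hg.hexAdj hs₁ (fun h => hyz (by rw [h])) hy hz
  · intro z hz
    obtain ⟨A₁, hA₁, g, hg, hE₁, ⟨h1, h2, h3⟩, hx⟩ := hσ z
    rcases hz with hz | hz | hz <;> rw [hz] at hx ⊢
    · rw [← hx, h1]
    · rw [← hx, h2]
    · rw [← hx, h3]

end Building

/-! ### Distances, links and simple connectedness of a building -/

section BuildingGeometry

variable {V : Type u} {K : AbstractSimplicialComplex V} {𝒜 : Set (Set (Finset V))}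

theorem IsBuildingOfTypeTildeA2.exists_system (h : IsBuildingOfTypeTildeA2 K) :
    ∃ 𝒜, 𝒜.Nonempty ∧ IsApartmentSystem K 𝒜 := h

theorem IsApartmentSystem.exists_chart (h𝒜 : IsApartmentSystem K 𝒜) {s t : Finset V}
    (hs : s ∈ K.faces) (ht : t ∈ K.faces) :
    ∃ A ∈ 𝒜, ∃ f, IsChart f A ∧ s ∈ A ∧ t ∈ A := by
  obtain ⟨A, hA, h⟩ := h𝒜.2.1 s hs t ht
  obtain ⟨f, hf⟩ := (h𝒜.1 A hA).2
  exact ⟨A, hA, f, hf, h⟩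

theorem IsApartmentSystem.reachable (h𝒜 : IsApartmentSystem K 𝒜) (y z : V) :
    (oneSkeleton K).Reachable y z := by
  obtain ⟨A, hA, f, hf, hy, hz⟩ := h𝒜.exists_chart (K.singleton_mem y) (K.singleton_mem z)
  obtain ⟨p, hp⟩ := hf.exists_eq hy (Finset.mem_singleton_self y)
  obtain ⟨q, hq⟩ := hf.exists_eq hz (Finset.mem_singleton_self z)
  have := hex_connected (S := fun x => (oneSkeleton K).Reachable (f p) (f x)) (p := p)
    (SimpleGraph.Reachable.refl _) (fun x x' h hx => h.trans (h𝒜.adj_chart hA hf hx).reachable) q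
  rwa [hp, hq] at this

theorem IsBuildingOfTypeTildeA2.connected (h : IsBuildingOfTypeTildeA2 K) :
    (oneSkeleton K).Connected := by
  obtain ⟨𝒜, ⟨A, hA⟩, h𝒜⟩ := h.exists_system
  obtain ⟨f, -⟩ := (h𝒜.1 A hA).2
  have : Nonempty V := ⟨f 0⟩
  exact ⟨h𝒜.reachable⟩

theorem hexNorm_le_length {σ : V → ℤ × ℤ}
    (hσ : ∀ y z, (oneSkeleton K).Adj y z → hexAdj (σ y) (σ z)) {y z : V}
    (w : (oneSkeleton K).Walk y z) : hexNorm (σ z - σ y) ≤ w.length := by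
  induction w with
  | nil => simp [hexNorm_zero]
  | @cons a b c hab w ih =>
    have h : hexAdj (σ c - σ b) (σ c - σ a) := by
      have := hσ _ _ hab
      unfold hexAdj at *
      simpa using this
    have := hexNorm_le_of_hexAdj h
    rw [SimpleGraph.Walk.length_cons]
    omega

theorem IsApartmentSystem.hexNorm_le_dist (h𝒜 : IsApartmentSystem K 𝒜) {σ : V → ℤ × ℤ}
    (hσ : ∀ y z, (oneSkeleton K).Adj y z → hexAdj (σ y) (σ z)) (y z : V) :
    hexNorm (σ z - σ y) ≤ (oneSkeleton K).dist y z := by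
  obtain ⟨w, hw⟩ := (h𝒜.reachable y z).exists_walk_length_eq_dist
  rw [← hw]
  exact hexNorm_le_length hσ w

/-- Apartments are isometrically embedded: a descending path inside the apartment gives the upper
bound, and a retraction, which preserves adjacency and so does not increase distances, gives the
lower bound. -/
theorem IsApartmentSystem.dist_chart (h𝒜 : IsApartmentSystem K 𝒜) {A : Set (Finset V)}
    (hA : A ∈ 𝒜) {f : ℤ × ℤ → V} (hf : IsChart f A) (p q : ℤ × ℤ) :
    (oneSkeleton K).dist (f p) (f q) = hexNorm (q - p) := by
  apply le_antisymm
  · have key : ∀ n, ∀ q : ℤ × ℤ, hexNorm (q - p) = n →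
        ∃ w : (oneSkeleton K).Walk (f p) (f q), w.length = n := by
      intro n
      induction n with
      | zero =>
        intro q hq
        obtain rfl := sub_eq_zero.1 (eq_zero_of_hexNorm hq)
        exact ⟨.nil, rfl⟩
      | succ n ih =>
        intro q hq
        have h0 : q - p ≠ 0 := fun h => by rw [h, hexNorm_zero] at hq; omega
        obtain ⟨r, _, hr, _, _, hrn, _⟩ := exists_descending_triangle h0
        have h1 := hexNorm_le_of_hexAdj hr.symm
        have h2 : hexAdj (r + p) q := by
          have := hr.symm
          unfold hexAdj at *
          rwa [sub_add_eq_sub_sub_swap]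
        obtain ⟨w, hw⟩ := ih (r + p) (by rw [add_sub_cancel_right]; omega)
        exact ⟨w.concat (h𝒜.adj_chart hA hf h2), by rw [SimpleGraph.Walk.length_concat, hw]⟩
    obtain ⟨w, hw⟩ := key _ q rfl
    rw [← hw]
    exact SimpleGraph.dist_le w
  · have h1 : hexAdj p (p + (1, 0)) := by simp [hexAdj, hexagonDirections]
    have h2 := hexAdj_hexRot h1
    obtain ⟨σ, hσ, hadj, -⟩ := h𝒜.exists_retraction hA hf h1 h2.1 h2.2
    simpa [hσ] using h𝒜.hexNorm_le_dist hadj (f p) (f q)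

theorem hexAdj_sub_right {p q o : ℤ × ℤ} : hexAdj (p - o) (q - o) ↔ hexAdj p q := by
  simp [hexAdj]

/-- The neighbours of `y` closer to `o` span a simplex with `y`. -/
theorem IsBuildingOfTypeTildeA2.eq_or_tri_of_dist_lt (h : IsBuildingOfTypeTildeA2 K)
    {o y z z' : V} (hz : (oneSkeleton K).Adj y z) (hz' : (oneSkeleton K).Adj y z')
    (hd : (oneSkeleton K).dist o z < (oneSkeleton K).dist o y)
    (hd' : (oneSkeleton K).dist o z' < (oneSkeleton K).dist o y) : z = z' ∨ Tri K y z z' := by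
  obtain ⟨𝒜, -, h𝒜⟩ := h.exists_system
  obtain ⟨A, hA, f, hf, ho, hy⟩ := h𝒜.exists_chart (K.singleton_mem o) (K.singleton_mem y)
  obtain ⟨p, rfl⟩ := hf.exists_eq ho (Finset.mem_singleton_self o)
  obtain ⟨q, rfl⟩ := hf.exists_eq hy (Finset.mem_singleton_self y)
  have hqp : q - p ≠ 0 := by
    intro h0
    rw [h𝒜.dist_chart hA hf p q, h0, hexNorm_zero] at hd
    omega
  obtain ⟨r₁, r₂, h1, h2, h3, -, h4⟩ := exists_descending_triangle hqp
  have key : ∀ r, hexAdj q r → hexNorm (r - p) < hexNorm (q - p) → r = r₁ + p ∨ r = r₂ + p := by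
    intro r hr hn
    rw [← sub_eq_iff_eq_add, ← sub_eq_iff_eq_add]
    exact h4 _ (hexAdj_sub_right.2 hr) hn
  have h1' : hexAdj q (r₁ + p) := by rwa [← hexAdj_sub_right (o := p), add_sub_cancel_right]
  have h2' : hexAdj q (r₂ + p) := by rwa [← hexAdj_sub_right (o := p), add_sub_cancel_right]
  have h3' : hexAdj (r₁ + p) (r₂ + p) := by
    rwa [← hexAdj_sub_right (o := p), add_sub_cancel_right, add_sub_cancel_right]
  -- Center the retraction at the descending triangle of `q`. A closer neighbour of `f q` retracts
  -- to a closer neighbour of `q`, that is, to a vertex of the center, and only that vertex itself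
  -- retracts there.
  obtain ⟨σ, hσ, hadj, hE⟩ := h𝒜.exists_retraction hA hf h1' h2' h3'
  have main : ∀ z, (oneSkeleton K).Adj (f q) z →
      (oneSkeleton K).dist (f p) z < (oneSkeleton K).dist (f p) (f q) →
      z = f (r₁ + p) ∨ z = f (r₂ + p) := by
    intro z hz hd
    have ha := hadj _ _ hz
    have hle := h𝒜.hexNorm_le_dist hadj (f p) z
    rw [h𝒜.dist_chart hA hf p q] at hd
    rw [hσ] at ha hle
    rcases key _ ha (by omega) with h | h
    · exact Or.inl (by rw [← h]; exact hE z (by tauto))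
    · exact Or.inr (by rw [← h]; exact hE z (by tauto))
  have htri := h𝒜.tri_chart hA hf h1' h2' h3'
  rcases main z hz hd with rfl | rfl <;> rcases main z' hz' hd' with rfl | rfl
  · exact Or.inl rfl
  · exact Or.inr htri
  · exact Or.inr htri.swap
  · exact Or.inl rfl

/-- Neighbours at the same distance from `o` have a common neighbour closer to `o`. -/
theorem IsBuildingOfTypeTildeA2.exists_tri_of_dist_eq (h : IsBuildingOfTypeTildeA2 K)
    {o y z : V} (hz : (oneSkeleton K).Adj y z)
    (hd : (oneSkeleton K).dist o y = (oneSkeleton K).dist o z) :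
    ∃ t, Tri K t y z ∧ (oneSkeleton K).dist o t < (oneSkeleton K).dist o y := by
  obtain ⟨𝒜, -, h𝒜⟩ := h.exists_system
  obtain ⟨hne, s, hs, hy, hz⟩ := hz
  obtain ⟨A, hA, f, hf, ho, hsA⟩ := h𝒜.exists_chart (K.singleton_mem o) hs
  obtain ⟨p, rfl⟩ := hf.exists_eq ho (Finset.mem_singleton_self o)
  obtain ⟨q, rfl⟩ := hf.exists_eq hsA hy
  obtain ⟨q', rfl⟩ := hf.exists_eq hsA hz
  have hqq := hf.hexAdj hsA (fun h => hne (by rw [h])) hy hz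
  rw [h𝒜.dist_chart hA hf, h𝒜.dist_chart hA hf] at hd
  obtain ⟨r, h1, h2, h3⟩ := exists_common_descending (hexAdj_sub_right.2 hqq) hd
  have h1' : hexAdj q (r + p) := by rwa [← hexAdj_sub_right (o := p), add_sub_cancel_right]
  have h2' : hexAdj q' (r + p) := by rwa [← hexAdj_sub_right (o := p), add_sub_cancel_right]
  refine ⟨f (r + p), h𝒜.tri_chart hA hf h1'.symm h2'.symm hqq, ?_⟩
  rwa [h𝒜.dist_chart hA hf, h𝒜.dist_chart hA hf, add_sub_cancel_right]

/-- The type of a point of the triangular lattice. -/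
def hexType (p : ℤ × ℤ) : ZMod 3 := ((p.1 - p.2 : ℤ) : ZMod 3)

theorem hexType_ne {p q : ℤ × ℤ} (h : hexAdj p q) : hexType p ≠ hexType q := by
  unfold hexType
  rw [Ne, ZMod.intCast_eq_intCast_iff_dvd_sub]
  rw [hexAdj_iff] at h
  push_cast
  omega

theorem exists_eq_of_four_types : ∀ a b c d : ZMod 3,
    a = b ∨ a = c ∨ a = d ∨ b = c ∨ c = d ∨ d = b := by
  decide

/-- The lattice has a proper 3-coloring, which is pulled back to the building along a retraction. -/
theorem IsBuildingOfTypeTildeA2.exists_type (h : IsBuildingOfTypeTildeA2 K) :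
    ∃ τ : V → ZMod 3, ∀ y z, (oneSkeleton K).Adj y z → τ y ≠ τ z := by
  obtain ⟨𝒜, ⟨A, hA⟩, h𝒜⟩ := h.exists_system
  obtain ⟨f, hf⟩ := (h𝒜.1 A hA).2
  have h1 : hexAdj 0 (0 + (1, 0)) := by simp [hexAdj, hexagonDirections]
  have h2 := hexAdj_hexRot h1
  obtain ⟨σ, -, hadj, -⟩ := h𝒜.exists_retraction hA hf h1 h2.1 h2.2
  exact ⟨fun y => hexType (σ y), fun y z hyz => hexType_ne (hadj y z hyz)⟩

/-- The link of a vertex is a (possibly degenerate) projective plane: distinct vertices of the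
same type have exactly one common neighbour. -/
theorem IsBuildingOfTypeTildeA2.existsUnique_common_neighbor (h : IsBuildingOfTypeTildeA2 K)
    {τ : V → ZMod 3} (hτ : ∀ y z, (oneSkeleton K).Adj y z → τ y ≠ τ z) {y z w : V}
    (hz : (oneSkeleton K).Adj y z) (hw : (oneSkeleton K).Adj y w) (hzw : z ≠ w)
    (ht : τ z = τ w) : ∃! u, Tri K y z u ∧ Tri K y w u := by
  obtain ⟨𝒜, -, h𝒜⟩ := h.exists_system
  obtain ⟨hyz, s, hs, hys, hzs⟩ := hz
  obtain ⟨hyw, t, ht', hyt, hwt⟩ := hw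
  obtain ⟨A, hA, f, hf, hsA, htA⟩ := h𝒜.exists_chart hs ht'
  obtain ⟨p, rfl⟩ := hf.exists_eq hsA hys
  obtain ⟨q, rfl⟩ := hf.exists_eq hsA hzs
  obtain ⟨r, rfl⟩ := hf.exists_eq htA hwt
  have hpq := hf.hexAdj hsA (fun h => hyz (by rw [h])) hys hzs
  have hpr := hf.hexAdj htA (fun h => hyw (by rw [h])) hyt hwt
  have hτf : ∀ a b, hexAdj a b → τ (f a) ≠ τ (f b) := fun a b hab =>
    hτ _ _ (h𝒜.adj_chart hA hf hab)
  have main : ∀ q r, hexAdj p q → r = hexRot p (hexRot p q) →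
      ∃! u, Tri K (f p) (f q) u ∧ Tri K (f p) (f r) u := by
    rintro q _ hpq rfl
    have h1 := hexAdj_hexRot hpq
    have h2 := hexAdj_hexRot h1.1
    refine ⟨f (hexRot p q), ⟨h𝒜.tri_chart hA hf hpq h1.1 h1.2,
      (h𝒜.tri_chart hA hf h1.1 h2.1 h2.2).swap⟩, ?_⟩
    rintro u ⟨hu1, hu2⟩
    -- A common neighbour `u` retracts to the common neighbour in the apartment. That one belongs to
    -- the central triangle, so `u` equals it.
    obtain ⟨σ, hσ, hadj, hE⟩ := h𝒜.exists_retraction hA hf hpq h1.1 h1.2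
    have a1 := hadj _ _ hu1.swap.adj
    have a2 := hadj _ _ hu1.rotate.adj
    have a3 := hadj _ _ hu2.rotate.adj
    rw [hσ] at a1 a2 a3
    have := eq_hexRot_of_hexAdj_three hpq a1 a2 a3
    rw [← this]
    exact hE u (by tauto)
  have h1 := hexAdj_hexRot hpq
  have h2 := hexAdj_hexRot h1.1
  have h3 := hexAdj_hexRot h2.1
  rcases eq_iterate_hexRot hpq hpr with rfl | rfl | h | rfl | h | rfl
  · exact absurd rfl hzw
  · exact absurd ht (hτf _ _ h1.2)
  · exact main q r hpq h
  -- Opposite corners of a hexagon have different types: around `p` only two types remain, and they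
  -- alternate.
  · have a0 := hτf _ _ hpq
    have a1 := hτf _ _ h1.1
    have a2 := hτf _ _ h2.1
    have b1 := hτf _ _ h1.2
    have b2 := hτf _ _ h2.2
    have b3 := hτf _ _ h3.2
    rw [← ht] at b3
    rcases exists_eq_of_four_types _ _ _ _ with h | h | h | h | h | h
    exacts [(a0 h).elim, (a1 h).elim, (a2 h).elim, (b1 h).elim, (b2 h).elim, (b3 h).elim]
  · simp only [and_comm (a := Tri K (f p) (f q) _)]
    exact main r q hpr h
  · exact absurd ht.symm (hτf _ _ (hexAdj_hexRot hpr).2)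

theorem IsBuildingOfTypeTildeA2.chamber (h : IsBuildingOfTypeTildeA2 K) {s : Finset V}
    (hs : IsChamber K s) : ∃ a b c, Tri K a b c ∧ ∀ x, x ∈ s ↔ x = a ∨ x = b ∨ x = c := by
  classical
  obtain ⟨𝒜, -, h𝒜⟩ := h.exists_system
  obtain ⟨A, hA, f, hf, hsA, -⟩ := h𝒜.exists_chart hs.1 hs.1
  obtain ⟨t, ht, rfl⟩ := hf.exists_preimage hsA
  obtain ⟨p, q, r, hpq, hpr, hqr, hsub⟩ := exists_triple_of_mem_coxeter ht
  refine ⟨f p, f q, f r, h𝒜.tri_chart hA hf hpq hpr hqr, fun x => ?_⟩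
  have := hs.2 _ ((h𝒜.1 A hA).1 (hf.image_mem (triple_mem_coxeter hpq hpr hqr)))
    (Finset.image_subset_image hsub)
  rw [← this]
  simp

/-- A building is simply connected: a connected graph which covers the 1-skeleton of a building,
so that the triangles lift, has a single vertex over each vertex of the building. -/
theorem IsBuildingOfTypeTildeA2.injective_of_covering (h : IsBuildingOfTypeTildeA2 K)
    {T : Type w} (p : T → V) (R : T → T → Prop) (hsymm : ∀ t t', R t t' → R t' t)
    (hadj : ∀ t t', R t t' → (oneSkeleton K).Adj (p t) (p t'))
    (hlift : ∀ t z, (oneSkeleton K).Adj (p t) z → ∃ t', R t t' ∧ p t' = z)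
    (hunique : ∀ t t' t'', R t t' → R t t'' → p t' = p t'' → t' = t'')
    (htri : ∀ t t' t'', R t t' → R t t'' → Tri K (p t) (p t') (p t'') → R t' t'')
    (hconn : ∀ t t', Relation.ReflTransGen R t t') : Function.Injective p := by
  intro t₀ t₁ h01
  set o := p t₀ with ho
  let d : V → ℕ := fun y => (oneSkeleton K).dist o y
  have hd : ∀ {y z}, (oneSkeleton K).Adj y z → d z ≤ d y + 1 := by
    intro y z hyz
    have := h.connected.dist_triangle (u := o) (v := y) (w := z)
    rwa [SimpleGraph.dist_eq_one_iff_adj.2 hyz] at this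
  -- `Q` is the sheet swept out from `t₀` by lifting geodesics issued from `o`. It is shown to be a
  -- section of `p`, then to be everything.
  let Q : T → Prop := Relation.ReflTransGen (fun t t' => R t t' ∧ d (p t') = d (p t) + 1) t₀
  have hQ : ∀ t t', Q t → R t t' → d (p t') = d (p t) + 1 → Q t' :=
    fun t t' ht hR hn => ht.tail ⟨hR, hn⟩
  have hexists : ∀ n y, d y = n → ∃ t, Q t ∧ p t = y := by
    intro n
    induction n with
    | zero =>
      intro y hy
      exact ⟨t₀, Relation.ReflTransGen.refl, (h.connected.dist_eq_zero_iff).1 hy⟩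
    | succ n ih =>
      intro y hy
      obtain ⟨w, hw⟩ := (h.connected o y).exists_walk_length_eq_dist
      obtain ⟨z, hzy, hz⟩ : ∃ z, (oneSkeleton K).Adj z y ∧ d z ≤ n := by
        have hnil : ¬ w.Nil := fun hn => by
          rw [← SimpleGraph.Walk.length_eq_zero_iff] at hn
          change (oneSkeleton K).dist o y = n + 1 at hy
          omega
        refine ⟨w.penultimate, w.adj_penultimate hnil, ?_⟩
        refine (SimpleGraph.dist_le w.dropLast).trans ?_
        change (oneSkeleton K).dist o y = n + 1 at hy
        simp
        omega
      have hzn : d z = n := by have := hd hzy; omega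
      obtain ⟨t, ht, rfl⟩ := ih z hzn
      obtain ⟨t', hR, rfl⟩ := hlift t y hzy
      exact ⟨t', hQ _ _ ht hR (by omega), rfl⟩
  have hQ0 : ∀ t, Q t → d (p t) = 0 → t = t₀ := by
    intro t ht h0
    rcases Relation.ReflTransGen.cases_tail ht with rfl | ⟨u, -, -, hu⟩
    · rfl
    · omega
  have hQs : ∀ t n, Q t → d (p t) = n + 1 → ∃ u, Q u ∧ R u t ∧ d (p u) = n := by
    intro t n ht hn
    rcases Relation.ReflTransGen.cases_tail ht with rfl | ⟨u, hu, hR, hd'⟩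
    · have : d o = 0 := SimpleGraph.dist_self
      rw [← ho] at hn
      omega
    · exact ⟨u, hu, hR, by omega⟩
  have main : ∀ n, (∀ t t', Q t → Q t' → p t = p t' → d (p t) = n → t = t') ∧
      ∀ t t', Q t → Q t' → (oneSkeleton K).Adj (p t) (p t') → d (p t) = n → d (p t') = n →
        R t t' := by
    intro n
    induction n with
    | zero =>
      have h0 : ∀ t t', Q t → Q t' → p t = p t' → d (p t) = 0 → t = t' := by
        intro t t' ht ht' hp hn
        rw [hQ0 t ht hn, hQ0 t' ht' (by rw [← hp, hn])]
      refine ⟨h0, fun t t' ht ht' ha hn hn' => ?_⟩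
      rw [hQ0 t ht hn, hQ0 t' ht' hn'] at ha
      exact absurd rfl ha.ne
    | succ n ih =>
      have hs : ∀ t t', Q t → Q t' → p t = p t' → d (p t) = n + 1 → t = t' := by
        intro t t' ht ht' hp hn
        obtain ⟨u, hu, hut, hun⟩ := hQs t n ht hn
        obtain ⟨u', hu', hut', hun'⟩ := hQs t' n ht' (by rw [← hp, hn])
        have a1 := hadj _ _ (hsymm _ _ hut)
        have a2 := hadj _ _ (hsymm _ _ hut')
        rw [← hp] at a2
        -- Two predecessors lie over closer neighbours of the same vertex, so they have equal or
        -- adjacent images. The induction hypothesis makes them equal or related, and lifting the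
        -- triangle identifies `t` and `t'`.
        rcases h.eq_or_tri_of_dist_lt (o := o) a1 a2 (by change d _ < d _; omega)
          (by change d _ < d _; omega) with heq | htr
        · rw [ih.1 u u' hu hu' heq hun] at hut
          exact hunique _ _ _ hut hut' hp
        · have huu := ih.2 u u' hu hu' htr.rotate.adj hun hun'
          have := htri u u' t huu hut htr.rotate
          exact hunique _ _ _ this hut' hp
      refine ⟨hs, fun t t' ht ht' ha hn hn' => ?_⟩
      -- An edge within a sphere is lifted together with the triangle joining it to a closer vertex.
      obtain ⟨x, hx, hxd⟩ := h.exists_tri_of_dist_eq (o := o) ha (hn.trans hn'.symm)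
      have hxn : d x = n := by
        have := hd hx.adj
        change d x < d _ at hxd
        omega
      obtain ⟨v, hv, rfl⟩ := hexists n x hxn
      obtain ⟨t₁, hR1, hp1⟩ := hlift v _ hx.adj
      obtain ⟨t₂, hR2, hp2⟩ := hlift v _ hx.swap.adj
      have hR := htri v t₁ t₂ hR1 hR2 (by rwa [hp1, hp2])
      have e1 := hs t₁ t (hQ _ _ hv hR1 (by rw [hp1]; omega)) ht hp1 (by rw [hp1, hn])
      have e2 := hs t₂ t' (hQ _ _ hv hR2 (by rw [hp2]; omega)) ht' hp2 (by rw [hp2, hn'])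
      rwa [e1, e2] at hR
  -- The sheet is closed under `R`, whether the distance increases, stays or decreases;
  -- connectedness concludes.
  have hall : ∀ t, Q t := by
    intro t
    induction hconn t₀ t with
    | refl => exact Relation.ReflTransGen.refl
    | @tail t t' _ hR ht =>
      have ha := hadj _ _ hR
      have h1 := hd ha
      have h2 := hd ha.symm
      by_cases hc1 : d (p t') = d (p t) + 1
      · exact hQ _ _ ht hR hc1
      obtain ⟨s, hs, hps⟩ := hexists _ (p t') rfl
      by_cases hc2 : d (p t') = d (p t)
      · have hR' := (main _).2 t s ht hs (by rwa [hps]) rfl (by rw [hps, hc2])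
        rwa [hunique _ _ _ hR hR' hps.symm]
      · obtain ⟨t'', hR', hp'⟩ := hlift s (p t) (by rw [hps]; exact ha.symm)
        have := (main _).1 t'' t (hQ _ _ hs hR' (by rw [hp', hps]; omega)) ht hp' rfl
        rw [this] at hR'
        rwa [hunique _ _ _ hR (hsymm _ _ hR') hps.symm]
  exact (main _).1 t₀ t₁ (hall t₀) (hall t₁) h01 rfl

end BuildingGeometry

/-! ### Unique completion of a projective plane with few flags missing -/

/-- The incidence graph of a (possibly degenerate) projective plane: a graph with a proper
2-coloring such that distinct vertices of the same color have exactly one common neighbour. -/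
structure IsIncidenceGraph {V : Type u} (G : V → V → Prop) (κ : V → Bool) : Prop where
  symm : ∀ {a b}, G a b → G b a
  color_ne : ∀ {a b}, G a b → κ a ≠ κ b
  existsUnique : ∀ {a b}, a ≠ b → κ a = κ b → ∃! c, G a c ∧ G b c

section IncidenceGraph

variable {V : Type u} {L G G₁ : V → V → Prop} {κ κ₁ : V → Bool}

/-- There are no quadrilaterals; a common neighbour already forces `a` and `b` to have the same
color. -/
theorem IsIncidenceGraph.eq_left (hG : IsIncidenceGraph G κ) {a b c d : V} (hac : G a c)
    (hbc : G b c) (had : G a d) (hbd : G b d) (hab : a ≠ b) : c = d := by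
  refine (hG.existsUnique hab ?_).unique ⟨hac, hbc⟩ ⟨had, hbd⟩
  have h1 := hG.color_ne hac
  have h2 := hG.color_ne hbc
  revert h1 h2
  cases κ a <;> cases κ b <;> cases κ c <;> simp

/-- A graph `L` contained in `G` such that at most three edges of `G` are missing, and every
vertex of `L` has degree at least two. -/
structure IsNearlyFull (L G : V → V → Prop) : Prop where
  symm : ∀ {a b}, L a b → L b a
  le : ∀ {a b}, L a b → G a b
  degree : ∀ a, ∃ b c, b ≠ c ∧ L a b ∧ L a c
  few : ∀ {a b c d a' b' c' d'}, G a a' → ¬ L a a' → G b b' → ¬ L b b' → G c c' → ¬ L c c' →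
    G d d' → ¬ L d d' → s(a, a') = s(b, b') ∨ s(a, a') = s(c, c') ∨ s(a, a') = s(d, d') ∨
      s(b, b') = s(c, c') ∨ s(b, b') = s(d, d') ∨ s(c, c') = s(d, d')

theorem IsNearlyFull.exists_ne (h : IsNearlyFull L G) (a b : V) : ∃ c, c ≠ b ∧ L a c := by
  obtain ⟨c, d, hcd, hc, hd⟩ := h.degree a
  by_cases hcb : c = b
  · exact ⟨d, fun h => hcd (hcb.trans h.symm), hd⟩
  · exact ⟨c, hcb, hc⟩

/-- Missing edges on disjoint paths. -/
theorem IsNearlyFull.few_of_color (hL : IsNearlyFull L G) (hG : IsIncidenceGraph G κ)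
    {a b c d a' b' c' d' : V} (ha : G a a') (ha' : ¬ L a a') (hb : G b b') (hb' : ¬ L b b')
    (hc : G c c') (hc' : ¬ L c c') (hd : G d d') (hd' : ¬ L d d') (hab : κ a = κ b)
    (hac : κ a = κ c) (had : κ a = κ d) :
    (a = b ∧ a' = b') ∨ (a = c ∧ a' = c') ∨ (a = d ∧ a' = d') ∨ (b = c ∧ b' = c') ∨
      (b = d ∧ b' = d') ∨ (c = d ∧ c' = d') := by
  have key : ∀ {x x' y y' : V}, G x x' → κ x = κ y → s(x, x') = s(y, y') → x = y ∧ x' = y' := by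
    intro x x' y y' hx hxy h
    rcases Sym2.eq_iff.1 h with h | ⟨h1, h2⟩
    · exact h
    · rw [h2] at hx
      exact absurd hxy (hG.color_ne hx)
  rcases hL.few ha ha' hb hb' hc hc' hd hd' with h | h | h | h | h | h
  · exact Or.inl (key ha hab h)
  · exact Or.inr (Or.inl (key ha hac h))
  · exact Or.inr (Or.inr (Or.inl (key ha had h)))
  · exact Or.inr (Or.inr (Or.inr (Or.inl (key hb (hab.symm.trans hac) h))))
  · exact Or.inr (Or.inr (Or.inr (Or.inr (Or.inl (key hb (hab.symm.trans had) h)))))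
  · exact Or.inr (Or.inr (Or.inr (Or.inr (Or.inr (key hc (hac.symm.trans had) h)))))

theorem bool_eq_of_ne_of_ne {a b c : Bool} (h : a ≠ b) (h' : b ≠ c) : a = c := by
  cases a <;> cases b <;> cases c <;> simp_all

/-- `L` is connected enough: a proper 2-coloring of `L` is proper on `G`. -/
theorem IsNearlyFull.color_ne (hL : IsNearlyFull L G) (hG : IsIncidenceGraph G κ)
    (hκ₁ : ∀ {a b}, L a b → κ₁ a ≠ κ₁ b) {p l : V} (hpl : G p l) : κ₁ p ≠ κ₁ l := by
  intro heq
  have hE : ¬ L p l := fun h => hκ₁ h heq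
  obtain ⟨r₁, r₂, hr, hr₁, hr₂⟩ := hL.degree p
  obtain ⟨a₁, a₂, ha, ha₁, ha₂⟩ := hL.degree l
  have hrl : ∀ {r}, L p r → r ≠ l := fun h h' => hE (h' ▸ h)
  have hap : ∀ {a}, L l a → a ≠ p := fun h h' => hE (hL.symm (h' ▸ h))
  obtain ⟨c₁, hc₁p, hc₁⟩ := hL.exists_ne r₁ p
  obtain ⟨c₂, hc₂p, hc₂⟩ := hL.exists_ne r₂ p
  -- the line through `c` and `a` is incomplete
  have path : ∀ r c a, L p r → c ≠ p → L r c → L l a → ∃ s, G c s ∧ G a s ∧ s ≠ l ∧ s ≠ r ∧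
      κ p = κ c ∧ κ p = κ a ∧ (¬ L c s ∨ ¬ L a s) := by
    intro r c a hr hc hrc hla
    have hca : c ≠ a := by
      rintro rfl
      have := hG.eq_left (hL.le hr) (hG.symm (hL.le hrc)) hpl (hG.symm (hL.le hla)) hc.symm
      exact hrl hr this
    have k1 : κ p = κ c := bool_eq_of_ne_of_ne (hG.color_ne (hL.le hr)) (hG.color_ne (hL.le hrc))
    have k2 : κ p = κ a := bool_eq_of_ne_of_ne (hG.color_ne hpl) (hG.color_ne (hL.le hla))
    obtain ⟨s, ⟨hs1, hs2⟩, -⟩ := hG.existsUnique hca (k1.symm.trans k2)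
    refine ⟨s, hs1, hs2, ?_, ?_, k1, k2, ?_⟩
    · rintro rfl
      exact hrl hr (hG.eq_left (hL.le hr) (hG.symm (hL.le hrc)) hpl hs1 hc.symm)
    · rintro rfl
      exact hrl hr (hG.eq_left (hL.le hr) hs2 hpl (hG.symm (hL.le hla)) (hap hla).symm)
    -- If both edges were in `L`, then p, r, c, s, a, l would be a path of odd length in `L`, so
    -- `κ₁` would separate `p` from `l`.
    · by_contra! h
      have e1 := bool_eq_of_ne_of_ne (hκ₁ hr) (hκ₁ hrc)
      have e2 := bool_eq_of_ne_of_ne (hκ₁ h.1) (hκ₁ (hL.symm h.2))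
      have e3 := hκ₁ hla
      rw [← e2, ← e1, heq] at e3
      exact e3 rfl
  have hc12 : c₁ ≠ c₂ := by
    rintro rfl
    exact hr (hG.eq_left (hL.le hr₁) (hG.symm (hL.le hc₁)) (hL.le hr₂) (hG.symm (hL.le hc₂))
      hc₁p.symm)
  obtain ⟨s11, g11, g11', n11, m11, k1, k1', e11⟩ := path r₁ c₁ a₁ hr₁ hc₁p hc₁ ha₁
  obtain ⟨s12, g12, g12', n12, m12, -, k2', e12⟩ := path r₁ c₁ a₂ hr₁ hc₁p hc₁ ha₂
  obtain ⟨s21, g21, g21', n21, m21, k2, -, e21⟩ := path r₂ c₂ a₁ hr₂ hc₂p hc₂ ha₁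
  obtain ⟨s22, g22, g22', n22, m22, -, -, e22⟩ := path r₂ c₂ a₂ hr₂ hc₂p hc₂ ha₂
  have ga₁ := hG.symm (hL.le ha₁)
  have ga₂ := hG.symm (hL.le ha₂)
  have d1 : s11 ≠ s12 := by
    rintro rfl
    exact n11 (hG.eq_left g11' g12' ga₁ ga₂ ha)
  have d2 : s21 ≠ s22 := by
    rintro rfl
    exact n21 (hG.eq_left g21' g22' ga₁ ga₂ ha)
  have d3 : s11 ≠ s22 := by
    rintro rfl
    exact n11 (hG.eq_left g11' g22' ga₁ ga₂ ha)
  have d4 : s12 ≠ s21 := by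
    rintro rfl
    exact n12 (hG.eq_left g12' g21' ga₂ ga₁ ha.symm)
  have d5 : s11 = s21 → s12 ≠ s22 := by
    rintro rfl rfl
    exact d1 (hG.eq_left g11 g21 g12 g22 hc12)
  have edge : ∀ {c a s : V}, G c s → G a s → κ p = κ c → κ p = κ a → (¬ L c s ∨ ¬ L a s) →
      ∃ x, G x s ∧ ¬ L x s ∧ κ p = κ x := by
    rintro c a s h1 h2 h3 h4 (h | h)
    · exact ⟨c, h1, h, h3⟩
    · exact ⟨a, h2, h, h4⟩
  obtain ⟨x11, f11, f11', q11⟩ := edge g11 g11' k1 k1' e11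
  obtain ⟨x12, f12, f12', q12⟩ := edge g12 g12' k1 k2' e12
  -- Among the four `s` at least three are distinct, and each carries a missing edge. With the edge
  -- from `p` to `l` this makes four missing edges.
  by_cases d6 : s11 = s21
  · obtain ⟨x22, f22, f22', q22⟩ := edge g22 g22' k2 k2' e22
    have := hL.few_of_color hG hpl hE f11 f11' f12 f12' f22 f22' q11 q12 q22
    have := d5 d6
    grind
  · obtain ⟨x21, f21, f21', q21⟩ := edge g21 g21' k2 k1' e21
    have := hL.few_of_color hG hpl hE f11 f11' f12 f12' f21 f21' q11 q12 q21
    grind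

/-- Both completions split the vertices into points and lines in the same way, so a single coloring
serves for both from here on. -/
theorem IsNearlyFull.isIncidenceGraph (hL : IsNearlyFull L G) (hG : IsIncidenceGraph G κ)
    (hL₁ : ∀ {a b}, L a b → G₁ a b) (hG₁ : IsIncidenceGraph G₁ κ₁) : IsIncidenceGraph G₁ κ := by
  have hκ : ∀ {a b}, G a b → κ₁ a ≠ κ₁ b := fun h =>
    hL.color_ne hG (fun h' => hG₁.color_ne (hL₁ h')) h
  have h1 : ∀ {a b}, κ a = κ b → κ₁ a = κ₁ b := by
    intro a b h
    by_cases hab : a = b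
    · rw [hab]
    · obtain ⟨c, ⟨hac, hbc⟩, -⟩ := hG.existsUnique hab h
      exact bool_eq_of_ne_of_ne (hκ hac) (hκ (hG.symm hbc))
  refine ⟨hG₁.symm, fun {a b} hab h => hG₁.color_ne hab (h1 h), fun {a b} hab h =>
    hG₁.existsUnique hab (h1 h)⟩

set_option maxHeartbeats 1000000 in
/-- Missing edges lie on the paths of length three between two vertices which are adjacent in
`G₁` but not in `G`. -/
theorem IsNearlyFull.missing_edge_near (hL : IsNearlyFull L G) (hG : IsIncidenceGraph G κ)
    (hL₁ : ∀ {a b}, L a b → G₁ a b) (hG₁ : IsIncidenceGraph G₁ κ) {p m : V} (h₁ : G₁ p m)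
    (h₀ : ¬ G p m) :
    (∃ b₁ b₂ b₃ r₁ r₂ r₃, b₁ ≠ b₂ ∧ b₁ ≠ b₃ ∧ b₂ ≠ b₃ ∧ L b₁ m ∧ L b₂ m ∧ G b₃ m ∧ L p r₁ ∧
      G p r₂ ∧ G p r₃ ∧ G b₁ r₁ ∧ G b₂ r₂ ∧ G b₃ r₃ ∧ ¬ L b₁ r₁ ∧ (¬ L b₂ r₂ ∨ ¬ L p r₂) ∧
      (¬ L b₃ m ∨ ¬ L b₃ r₃ ∨ ¬ L p r₃)) ∧
    ∀ u v, κ u = κ p → G u v → ¬ L u v → u = p ∨ v = m ∨ (G u m ∧ G p v) := by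
  have hpm := hG₁.color_ne h₁
  have hkey : ∀ {b}, G b m → κ b = κ p := fun {b} hb =>
    bool_eq_of_ne_of_ne (hG.color_ne hb) hpm.symm
  have hbp : ∀ {b}, G b m → b ≠ p := fun h h' => h₀ (h' ▸ h)
  have hrm : ∀ {r}, G p r → r ≠ m := fun h h' => h₀ (h' ▸ h)
  have hkr : ∀ {r}, G p r → κ r = κ m := fun {r} hr =>
    bool_eq_of_ne_of_ne (hG.color_ne hr).symm hpm
  -- paths from `m` to `p`, starting from either end
  have proj : ∀ b, G b m → ∃ r, G p r ∧ G b r := by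
    intro b hb
    obtain ⟨r, ⟨h1, h2⟩, -⟩ := hG.existsUnique (hbp hb) (hkey hb)
    exact ⟨r, h2, h1⟩
  have proj' : ∀ r, G p r → ∃ b, G b m ∧ G b r := by
    intro r hr
    obtain ⟨b, ⟨h1, h2⟩, -⟩ := hG.existsUnique (hrm hr) (hkr hr)
    exact ⟨b, hG.symm h2, hG.symm h1⟩
  have inj : ∀ {b b' r r'}, G b m → G b' m → G p r → G p r' → G b r → G b' r' → b ≠ b' →
      r ≠ r' := by
    rintro b b' r _ hb hb' hr - hbr hbr' hne rfl
    exact hrm hr (hG.eq_left hbr hbr' hb hb' hne)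
  have inj' : ∀ {b r r'}, G b m → G p r → G p r' → G b r → G b r' → r = r' :=
    fun hb hr hr' hbr hbr' => hG.eq_left hbr hr hbr' hr' (hbp hb)
  -- A path m, b, r, p inside `L` would be closed by the edge from `p` to `m` into a quadrilateral
  -- of `G₁`.
  have miss : ∀ {b r}, G b m → G p r → G b r → ¬ L b m ∨ ¬ L b r ∨ ¬ L p r := by
    intro b r hb hr hbr
    by_contra! h
    exact hrm hr (hG₁.eq_left (hL₁ h.2.1) (hL₁ h.2.2) (hL₁ h.1) h₁ (hbp hb))
  have edge : ∀ {b r}, G b m → G p r → G b r → (¬ L b m ∨ ¬ L b r ∨ ¬ L p r) →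
      ∃ u v, G u v ∧ ¬ L u v ∧ κ p = κ u ∧
        ((u = b ∧ v = m) ∨ (u = b ∧ v = r) ∨ (u = p ∧ v = r)) := by
    rintro b r hb hr hbr (h | h | h)
    · exact ⟨b, m, hb, h, (hkey hb).symm, by simp⟩
    · exact ⟨b, r, hbr, h, (hkey hb).symm, by simp⟩
    · exact ⟨p, r, hr, h, rfl, by simp⟩
  -- Some path lacks its middle edge while both end edges are in `L`. Otherwise two `L`-neighbours
  -- of `m` force two missing edges at `p`, and two `L`-neighbours of `p` force two at `m`.
  obtain ⟨b₁, r₁, hb₁, hr₁, hbr₁, hE₁⟩ : ∃ b r, L b m ∧ L p r ∧ G b r ∧ ¬ L b r := by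
    by_contra! hno
    obtain ⟨b, b', hbb, hb, hb'⟩ := hL.degree m
    obtain ⟨r, r', hrr, hr, hr'⟩ := hL.degree p
    have gb := hL.le (hL.symm hb)
    have gb' := hL.le (hL.symm hb')
    have gr := hL.le hr
    have gr' := hL.le hr'
    obtain ⟨s, hs, hbs⟩ := proj b gb
    obtain ⟨s', hs', hbs'⟩ := proj b' gb'
    obtain ⟨c, hc, hcr⟩ := proj' r gr
    obtain ⟨c', hc', hcr'⟩ := proj' r' gr'
    have e1 : ¬ L p s := fun h => by
      have := miss gb hs hbs
      have := hL.symm hb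
      have := hno b s this h hbs
      tauto
    have e2 : ¬ L p s' := fun h => by
      have := miss gb' hs' hbs'
      have := hL.symm hb'
      have := hno b' s' this h hbs'
      tauto
    have e3 : ¬ L c m := fun h => by
      have := miss hc gr hcr
      have := hno c r h hr hcr
      tauto
    have e4 : ¬ L c' m := fun h => by
      have := miss hc' gr' hcr'
      have := hno c' r' h hr' hcr'
      tauto
    have hss := inj gb gb' hs hs' hbs hbs' hbb
    have hcc : c ≠ c' := by
      rintro rfl
      exact hrr (inj' hc gr gr' hcr hcr')
    have := hL.few_of_color hG hs e1 hs' e2 hc e3 hc' e4 rfl (hkey hc).symm (hkey hc').symm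
    have := hbp hc
    have := hbp hc'
    grind
  obtain ⟨b₂, hb₂₁, hb₂'⟩ := hL.exists_ne m b₁
  have hb₂ := hL.symm hb₂'
  have gb₁ := hL.le hb₁
  have gb₂ := hL.le hb₂
  have gr₁ := hL.le hr₁
  obtain ⟨r₂, gr₂, hbr₂⟩ := proj b₂ gb₂
  have hr12 := inj gb₁ gb₂ gr₁ gr₂ hbr₁ hbr₂ hb₂₁.symm
  have hE₂ : ¬ L b₂ r₂ ∨ ¬ L p r₂ := by
    have := miss gb₂ gr₂ hbr₂
    tauto
  -- A third path. If the second `L`-neighbour of `p` only gives back `b₂`, then the lines `r₁` and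
  -- `r'` have further points `t₁` and `t₂`, and the line joining these meets `m` in a third point.
  obtain ⟨b₃, gb₃, hb₃₁, hb₃₂⟩ : ∃ b₃, G b₃ m ∧ b₃ ≠ b₁ ∧ b₃ ≠ b₂ := by
    obtain ⟨r', hr'1, hr'⟩ := hL.exists_ne p r₁
    have gr' := hL.le hr'
    obtain ⟨b', hb', hbr'⟩ := proj' r' gr'
    have hb'1 : b' ≠ b₁ := by
      rintro rfl
      exact hr'1 (inj' hb' gr' gr₁ hbr' hbr₁)
    by_cases hb'2 : b' = b₂
    · subst hb'2
      have hrr : r' = r₂ := inj' hb' gr' gr₂ hbr' hbr₂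
      subst hrr
      have hE₂' : ¬ L b' r' := by tauto
      obtain ⟨t₁, ht₁p, ht₁⟩ := hL.exists_ne r₁ p
      obtain ⟨t₂, ht₂p, ht₂⟩ := hL.exists_ne r' p
      have gt₁ := hG.symm (hL.le ht₁)
      have gt₂ := hG.symm (hL.le ht₂)
      have ht₁b : t₁ ≠ b₁ := by
        rintro rfl
        exact hE₁ (hL.symm ht₁)
      have ht₂b : t₂ ≠ b' := by
        rintro rfl
        exact hE₂' (hL.symm ht₂)
      have ht12 : t₁ ≠ t₂ := by
        rintro rfl
        exact hr'1 (hG.eq_left gt₂ gr' gt₁ gr₁ ht₁p)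
      have k1 : κ t₁ = κ p := bool_eq_of_ne_of_ne (hG.color_ne gt₁) (hG.color_ne gr₁).symm
      have k2 : κ t₂ = κ p := bool_eq_of_ne_of_ne (hG.color_ne gt₂) (hG.color_ne gr').symm
      obtain ⟨l, ⟨hl₁, hl₂⟩, -⟩ := hG.existsUnique ht12 (k1.trans k2.symm)
      have hlr₁ : l ≠ r₁ := by
        rintro rfl
        exact hr'1 (hG.eq_left gt₂ gr' hl₂ gr₁ ht₂p)
      have hlr₂ : l ≠ r' := by
        rintro rfl
        exact hr'1 (hG.eq_left hl₁ gr' gt₁ gr₁ ht₁p)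
      have hlm : l ≠ m := by
        rintro rfl
        exact hrm gr₁ (hG.eq_left gt₁ hbr₁ hl₁ gb₁ ht₁b)
      have k3 : κ l = κ m := bool_eq_of_ne_of_ne (hG.color_ne hl₁).symm (by rw [k1]; exact hpm)
      obtain ⟨w, ⟨hw1, hw2⟩, -⟩ := hG.existsUnique hlm k3
      refine ⟨w, hG.symm hw2, ?_, ?_⟩
      · rintro rfl
        exact hlr₁ (hG.eq_left hl₁ (hG.symm hw1) gt₁ hbr₁ ht₁b)
      · rintro rfl
        exact hlr₂ (hG.eq_left hl₂ (hG.symm hw1) gt₂ hbr₂ ht₂b)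
    · exact ⟨b', hb', hb'1, hb'2⟩
  obtain ⟨r₃, gr₃, hbr₃⟩ := proj b₃ gb₃
  have hE₃ := miss gb₃ gr₃ hbr₃
  refine ⟨⟨b₁, b₂, b₃, r₁, r₂, r₃, hb₂₁.symm, hb₃₁.symm, hb₃₂.symm, hb₁, hb₂, gb₃, hr₁, gr₂,
    gr₃, hbr₁, hbr₂, hbr₃, hE₁, hE₂, hE₃⟩, fun u v hu huv huv' => ?_⟩
  have hr13 := inj gb₁ gb₃ gr₁ gr₃ hbr₁ hbr₃ hb₃₁.symm
  have hr23 := inj gb₂ gb₃ gr₂ gr₃ hbr₂ hbr₃ hb₃₂.symm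
  obtain ⟨x₂, y₂, f₂, f₂', q₂, c₂⟩ := edge gb₂ gr₂ hbr₂ (Or.inr hE₂)
  obtain ⟨x₃, y₃, f₃, f₃', q₃, c₃⟩ := edge gb₃ gr₃ hbr₃ hE₃
  -- The three paths share no edge and each has a missing one, so a further missing edge must
  -- coincide with one of these.
  have hfew := hL.few_of_color hG huv huv' hbr₁ hE₁ f₂ f₂' f₃ f₃' (hu.trans (hkey gb₁).symm)
    (hu.trans q₂) (hu.trans q₃)
  have n1 := hbp gb₁
  have n2 := hbp gb₂
  have n3 := hbp gb₃
  have m1 := hrm gr₁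
  have m2 := hrm gr₂
  have m3 := hrm gr₃
  rcases hfew with ⟨rfl, rfl⟩ | ⟨rfl, rfl⟩ | ⟨rfl, rfl⟩ | ⟨rfl, rfl⟩ | ⟨rfl, rfl⟩ | ⟨rfl, rfl⟩
  · exact Or.inr (Or.inr ⟨gb₁, gr₁⟩)
  · rcases c₂ with ⟨rfl, rfl⟩ | ⟨rfl, rfl⟩ | ⟨rfl, rfl⟩ <;> tauto
  · rcases c₃ with ⟨rfl, rfl⟩ | ⟨rfl, rfl⟩ | ⟨rfl, rfl⟩ <;> tauto
  · grind
  · grind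
  · grind

/-- One edge of `G₁` outside `G` creates another one, at `c` or at `b₁`. By `missing_edge_near` the
missing edges must be near both, which is impossible. -/
theorem IsNearlyFull.le_of_isIncidenceGraph (hL : IsNearlyFull L G) (hG : IsIncidenceGraph G κ)
    (hL₁ : ∀ {a b}, L a b → G₁ a b) (hG₁ : IsIncidenceGraph G₁ κ) {p m : V} (h₁ : G₁ p m) :
    G p m := by
  by_contra h₀
  obtain ⟨⟨b₁, b₂, b₃, r₁, r₂, r₃, b12, b13, b23, hb₁, hb₂, gb₃, hr₁, gr₂, gr₃, hbr₁, hbr₂, hbr₃,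
    hE₁, hE₂, hE₃⟩, -⟩ := hL.missing_edge_near hG hL₁ hG₁ h₁ h₀
  have gb₁ := hL.le hb₁
  have gb₂ := hL.le hb₂
  have gr₁ := hL.le hr₁
  have hrm : ∀ {r}, G p r → r ≠ m := fun h h' => h₀ (h' ▸ h)
  have hbp : ∀ {b}, G b m → b ≠ p := fun h h' => h₀ (h' ▸ h)
  have kb : ∀ {b}, G b m → κ b = κ p := fun {b} hb =>
    bool_eq_of_ne_of_ne (hG.color_ne hb) (hG₁.color_ne h₁).symm
  have inj : ∀ {b b' r r'}, G b m → G b' m → G p r → G b r → G b' r' → b ≠ b' → r ≠ r' := by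
    rintro b b' r _ hb hb' hr hbr hbr' hne rfl
    exact hrm hr (hG.eq_left hbr hbr' hb hb' hne)
  have r12 := inj gb₁ gb₂ gr₁ hbr₁ hbr₂ b12
  have r13 := inj gb₁ gb₃ gr₁ hbr₁ hbr₃ b13
  have r23 := inj gb₂ gb₃ gr₂ hbr₂ hbr₃ b23
  obtain ⟨c, hcp, hcr⟩ := hL.exists_ne r₁ p
  have hcr₁ := hL.symm hcr
  have gcr₁ := hL.le hcr₁
  have hcb₁ : c ≠ b₁ := by
    rintro rfl
    exact hE₁ hcr₁
  have kc : κ c = κ b₁ := bool_eq_of_ne_of_ne (hG.color_ne gcr₁) (hG.color_ne hbr₁).symm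
  have kcp : κ c = κ p := kc.trans (kb gb₁)
  -- the line of `G₁` through `c` and `b₁`
  obtain ⟨w, ⟨hcw, hbw⟩, -⟩ := hG₁.existsUnique hcb₁ kc
  have hbr₁' : ¬ G₁ b₁ r₁ := fun h =>
    hrm gr₁ (hG₁.eq_left h (hL₁ hr₁) (hL₁ hb₁) h₁ (hbp gb₁))
  have hwr₁ : w ≠ r₁ := by
    rintro rfl
    exact hbr₁' hbw
  have hwm : w ≠ m := by
    rintro rfl
    exact hrm gr₁ (hG₁.eq_left (hL₁ hcr₁) (hL₁ hr₁) hcw h₁ hcp)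
  have hcm : ¬ G c m := fun h => hrm gr₁ (hG.eq_left gcr₁ hbr₁ h gb₁ hcb₁)
  have pr : ∀ {x r}, G x r₁ → G p r → x ≠ p → r ≠ r₁ → ¬ G x r := fun hx hr hxp hne h =>
    hne (hG.eq_left h hr hx gr₁ hxp)
  -- In `G` the vertices `c` and `b₁` are joined by `r₁`, which differs from `w`. So one of the two
  -- edges of `G₁` ending at `w` is not in `G`. When it starts at `c`, the missing edge of the
  -- second path is not near it.
  by_cases hbwG : G b₁ w
  · have hcwG : ¬ G c w := fun h => hwr₁ (hG.eq_left h hbwG gcr₁ hbr₁ hcb₁)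
    have K := (hL.missing_edge_near hG hL₁ hG₁ hcw hcwG).2
    have hr₂w : r₂ ≠ w := by
      rintro rfl
      exact pr hbr₁ gr₂ (hbp gb₁) r12.symm hbwG
    have hcr₂ := pr gcr₁ gr₂ hcp r12.symm
    rcases hE₂ with h | h
    · rcases K b₂ r₂ ((kb gb₂).trans kcp.symm) hbr₂ h with h | h | h
      · exact hcm (h ▸ gb₂)
      · exact hr₂w h
      · exact hcr₂ h.2
    · rcases K p r₂ kcp.symm gr₂ h with h | h | h
      · exact hcp h.symm
      · exact hr₂w h
      · exact hcr₂ h.2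
  -- When the new edge starts at `b₁`, the second path forces `w = r₂`, and then the missing edge of
  -- the third path is not near it.
  · have K := (hL.missing_edge_near hG hL₁ hG₁ hbw hbwG).2
    have hbr₂' := pr hbr₁ gr₂ (hbp gb₁) r12.symm
    have hbr₃' := pr hbr₁ gr₃ (hbp gb₁) r13.symm
    have hwr₂ : r₂ = w := by
      rcases hE₂ with h | h
      · rcases K b₂ r₂ ((kb gb₂).trans (kb gb₁).symm) hbr₂ h with h | h | h
        · exact absurd h.symm b12
        · exact h
        · exact absurd h.2 hbr₂'
      · rcases K p r₂ (kb gb₁).symm gr₂ h with h | h | h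
        · exact absurd h.symm (hbp gb₁)
        · exact h
        · exact absurd h.2 hbr₂'
    rcases hE₃ with h | h | h
    · rcases K b₃ m ((kb gb₃).trans (kb gb₁).symm) gb₃ h with h | h | h
      · exact b13 h.symm
      · exact hwm h.symm
      · rw [← hwr₂] at h
        exact hrm gr₂ (hG.eq_left hbr₂ h.1 gb₂ gb₃ b23)
    · rcases K b₃ r₃ ((kb gb₃).trans (kb gb₁).symm) hbr₃ h with h | h | h
      · exact b13 h.symm
      · exact r23 (hwr₂.trans h.symm)
      · exact hbr₃' h.2
    · rcases K p r₃ (kb gb₁).symm gr₃ h with h | h | h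
      · exact hbp gb₁ h.symm
      · exact r23 (hwr₂.trans h.symm)
      · exact hbr₃' h.2

/-- A projective plane with at most three flags missing can be completed in one way only. -/
theorem IsNearlyFull.completion_unique (hL : IsNearlyFull L G) (hG : IsIncidenceGraph G κ)
    (hL₁ : ∀ {a b}, L a b → G₁ a b) (hG₁ : IsIncidenceGraph G₁ κ₁) (p l : V) :
    G p l ↔ G₁ p l := by
  have hG₁' := hL.isIncidenceGraph hG hL₁ hG₁
  refine ⟨fun h => ?_, hL.le_of_isIncidenceGraph hG hL₁ hG₁'⟩
  -- The reverse inclusion: join `p` in `G₁` to another vertex `a` on `l`. The joining line also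
  -- joins them in `G`, so it is `l`.
  obtain ⟨a, hap, hla⟩ := hL.exists_ne l p
  have hal := hL.symm hla
  obtain ⟨s, ⟨hs, hs'⟩, -⟩ := hG₁'.existsUnique hap
    (bool_eq_of_ne_of_ne (hG.color_ne (hL.le hal)) (hG.color_ne h).symm)
  have := hG.eq_left (hL.le_of_isIncidenceGraph hG hL₁ hG₁' hs)
    (hL.le_of_isIncidenceGraph hG hL₁ hG₁' hs') (hL.le hal) h hap
  rwa [← this]

end IncidenceGraph

/-! ### Points of the geometric realization -/

section Points

variable {V : Type u} {K : AbstractSimplicialComplex V}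

theorem single_mem_realization (x : V) : Finsupp.single x (1 : ℝ) ∈ realization K := by
  refine ⟨?_, fun y => ?_, by simp⟩
  · rw [Finsupp.support_single x one_ne_zero]
    exact K.singleton_mem x
  · classical
    rw [Finsupp.single_apply]
    split_ifs <;> simp

/-- The barycenter of a simplex. -/
noncomputable def barycenter (s : Finset V) : V →₀ ℝ :=
  Finsupp.indicator s fun _ _ => (s.card : ℝ)⁻¹

open Classical in
theorem barycenter_apply (s : Finset V) (x : V) :
    barycenter s x = if x ∈ s then (s.card : ℝ)⁻¹ else 0 := by
  simp [barycenter, Finsupp.indicator_apply]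

theorem support_barycenter {s : Finset V} (hs : s.Nonempty) : (barycenter s).support = s := by
  classical
  ext x
  have : (s.card : ℝ) ≠ 0 := by exact_mod_cast hs.card_pos.ne'
  simp [barycenter_apply, hs.ne_empty]

theorem barycenter_mem_realization {s : Finset V} (hs : s ∈ K.faces) :
    barycenter s ∈ realization K := by
  classical
  have hne : s.Nonempty := (K.isRelLowerSet_faces hs).1
  refine ⟨by rwa [support_barycenter hne], fun x => ?_, ?_⟩
  · rw [barycenter_apply]
    split_ifs
    · positivity
    · exact le_rfl
  · rw [Finsupp.sum, support_barycenter hne,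
      Finset.sum_congr rfl fun x hx => by rw [barycenter_apply, if_pos hx]]
    have : (s.card : ℝ) ≠ 0 := by exact_mod_cast hne.card_pos.ne'
    simp [this]

/-- A point of the edge from `x` to `y`, closer to `x`. -/
noncomputable def edgePoint (x y : V) : V →₀ ℝ :=
  Finsupp.single x (2 / 3) + Finsupp.single y (1 / 3)

theorem support_edgePoint [DecidableEq V] {x y : V} (h : x ≠ y) :
    (edgePoint x y).support = {x, y} := by
  have h1 : (Finsupp.single x (2 / 3 : ℝ)).support = {x} :=
    Finsupp.support_single x (by norm_num)
  have h2 : (Finsupp.single y (1 / 3 : ℝ)).support = {y} :=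
    Finsupp.support_single y (by norm_num)
  rw [edgePoint, Finsupp.support_add_eq, h1, h2]
  · rfl
  · rw [h1, h2]
    simpa using h

theorem edgePoint_mem_realization {x y : V} (h : (oneSkeleton K).Adj x y) :
    edgePoint x y ∈ realization K := by
  classical
  rw [adj_iff] at h
  refine ⟨?_, fun z => ?_, ?_⟩
  · rw [support_edgePoint h.1]
    exact h.2
  · simp only [edgePoint, Finsupp.add_apply, Finsupp.single_apply]
    split_ifs <;> norm_num
  · rw [edgePoint, Finsupp.sum_add_index' (by simp) (by simp)]
    norm_num

theorem mapDomain_edgePoint {W : Type v} (f : V → W) (x y : V) :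
    (edgePoint x y).mapDomain f = edgePoint (f x) (f y) := by
  rw [edgePoint, Finsupp.mapDomain_add, Finsupp.mapDomain_single, Finsupp.mapDomain_single,
    edgePoint]

/-- The weights 2/3 and 1/3 differ, so the point remembers the orientation of the edge; a midpoint
would not. -/
theorem edgePoint_injective {x y x' y' : V} (h : x ≠ y)
    (heq : edgePoint x y = edgePoint x' y') : x = x' ∧ y = y' := by
  classical
  have h1 := DFunLike.congr_fun heq x
  have h2 := DFunLike.congr_fun heq y
  simp only [edgePoint, Finsupp.add_apply, Finsupp.single_apply, if_neg h, if_neg h.symm] at h1 h2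
  constructor
  · by_contra hne
    rw [if_neg (Ne.symm hne)] at h1
    split_ifs at h1 <;> norm_num at h1
  · by_contra hne
    rw [if_neg (Ne.symm hne)] at h2
    split_ifs at h2 <;> norm_num at h2

theorem mapDomain_edgePoint_eq_iff {γ : Equiv.Perm V} {x y x' y' : V} (h : x ≠ y) :
    (edgePoint x y).mapDomain γ = edgePoint x' y' ↔ γ x = x' ∧ γ y = y' := by
  rw [mapDomain_edgePoint]
  refine ⟨edgePoint_injective (by simpa using h), ?_⟩
  rintro ⟨rfl, rfl⟩
  rfl

theorem edgePoint_ne_single {x y z : V} (h : x ≠ y) : edgePoint x y ≠ Finsupp.single z 1 := by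
  classical
  intro heq
  have h1 := congrArg Finsupp.support heq
  rw [support_edgePoint h, Finsupp.support_single z one_ne_zero] at h1
  have := congrArg Finset.card h1
  rw [Finset.card_pair h, Finset.card_singleton] at this
  omega

end Points

/-! ### Free actions: no fixed simplices -/

section Pairs

variable {P : Pair.{u}}

/-- The barycenter is a fixed point. So freeness excludes not only fixed vertices but also flipped
edges and rotated triangles. -/
theorem Pair.eq_one_of_stabilizes {γ : Equiv.Perm P.Vert} (hγ : γ ∈ P.grp) {s : Finset P.Vert}
    (hs : s ∈ P.cplx.faces) (h : ∀ x ∈ s, γ x ∈ s) : γ = 1 := by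
  classical
  refine P.free γ hγ _ (barycenter_mem_realization hs) ?_
  have himage : s.image γ = s := Finset.eq_of_subset_of_card_le
    (Finset.image_subset_iff.2 h) (Finset.card_image_of_injective s γ.injective).ge
  rw [← Finsupp.equivMapDomain_eq_mapDomain]
  ext x
  rw [Finsupp.equivMapDomain_apply, barycenter_apply, barycenter_apply]
  have : γ.symm x ∈ s ↔ x ∈ s := by
    constructor
    · intro hx
      simpa using h _ hx
    · intro hx
      rw [← himage] at hx
      obtain ⟨y, hy, rfl⟩ := Finset.mem_image.1 hx
      simpa using hy
  simp [this]

theorem Pair.eq_one_of_fixes {γ : Equiv.Perm P.Vert} (hγ : γ ∈ P.grp) {x : P.Vert}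
    (h : γ x = x) : γ = 1 :=
  P.eq_one_of_stabilizes hγ (P.cplx.singleton_mem x) (by simp [h])

theorem Pair.eq_of_apply_eq {γ δ : Equiv.Perm P.Vert} (hγ : γ ∈ P.grp) (hδ : δ ∈ P.grp)
    {x : P.Vert} (h : γ x = δ x) : γ = δ := by
  have : δ⁻¹ * γ = 1 := P.eq_one_of_fixes (P.grp.mul_mem (P.grp.inv_mem hδ) hγ) (x := x)
    (by simp [h])
  exact (inv_mul_eq_one.1 this).symm

theorem Pair.not_swap {γ : Equiv.Perm P.Vert} (hγ : γ ∈ P.grp) {x y : P.Vert}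
    (hxy : (oneSkeleton P.cplx).Adj x y) (h : γ x = y) (h' : γ y = x) : False := by
  classical
  have := P.eq_one_of_stabilizes hγ (adj_iff.1 hxy).2 (by simp [h, h'])
  rw [this] at h
  exact hxy.ne h

theorem Pair.not_rotate {γ : Equiv.Perm P.Vert} (hγ : γ ∈ P.grp) {x y z : P.Vert}
    (hxy : Tri P.cplx x y z) (h : γ x = y) (h' : γ y = z) (h'' : γ z = x) : False := by
  classical
  have := P.eq_one_of_stabilizes hγ (tri_iff.1 hxy).2.2.2 (by simp [h, h', h''])
  rw [this] at h
  exact hxy.1 h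

theorem Pair.map_adj {γ : Equiv.Perm P.Vert} (hγ : γ ∈ P.grp) {x y : P.Vert}
    (h : (oneSkeleton P.cplx).Adj x y) : (oneSkeleton P.cplx).Adj (γ x) (γ y) := by
  obtain ⟨hne, s, hs, hx, hy⟩ := h
  exact ⟨by simpa using hne, _, P.simplicial γ hγ s hs, by simpa using hx, by simpa using hy⟩

theorem Pair.map_tri {γ : Equiv.Perm P.Vert} (hγ : γ ∈ P.grp) {x y z : P.Vert}
    (h : Tri P.cplx x y z) : Tri P.cplx (γ x) (γ y) (γ z) := by
  obtain ⟨h1, h2, h3, s, hs, hx, hy, hz⟩ := h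
  exact ⟨by simpa using h1, by simpa using h2, by simpa using h3, _, P.simplicial γ hγ s hs,
    by simpa using hx, by simpa using hy, by simpa using hz⟩

end Pairs

/-! ### Local structure and equivariance of extensions -/

namespace Extension

variable {P : Pair.{u}} {P' : Pair.{v}} (e : Extension P P')

theorem exists_grp_vertex_iff {x y : P.Vert} :
    (∃ γ ∈ P.grp, γ x = y) ↔ ∃ γ ∈ P'.grp, γ (e.toFun x) = e.toFun y := by
  have := e.orbits _ (single_mem_realization x) _ (single_mem_realization y)
  simpa [Pair.SameOrbit, Finsupp.mapDomain_single, Finsupp.single_left_inj] using this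

/-- If an edge were collapsed, an interior point of it would have the image of a vertex, hence be
equivalent to that vertex in X, although their supports have different sizes. -/
theorem injective_on_edges {x y : P.Vert} (h : (oneSkeleton P.cplx).Adj x y) :
    e.toFun x ≠ e.toFun y := by
  intro heq
  have h1 : (edgePoint x y).mapDomain e.toFun = (Finsupp.single x 1).mapDomain e.toFun := by
    rw [mapDomain_edgePoint, Finsupp.mapDomain_single, edgePoint, heq, ← Finsupp.single_add]
    norm_num
  obtain ⟨γ, -, hγ⟩ := (e.orbits _ (edgePoint_mem_realization h) _ (single_mem_realization x)).2
    ⟨1, P'.grp.one_mem, by rw [h1]; exact Finsupp.mapDomain_id⟩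
  rw [mapDomain_edgePoint] at hγ
  exact edgePoint_ne_single (by simpa using h.ne) hγ

theorem map_adj {x y : P.Vert} (h : (oneSkeleton P.cplx).Adj x y) :
    (oneSkeleton P'.cplx).Adj (e.toFun x) (e.toFun y) := by
  classical
  obtain ⟨-, s, hs, hx, hy⟩ := id h
  exact ⟨e.injective_on_edges h, _, e.simplicial s hs, Finset.mem_image_of_mem _ hx,
    Finset.mem_image_of_mem _ hy⟩

theorem map_tri {x y z : P.Vert} (h : Tri P.cplx x y z) :
    Tri P'.cplx (e.toFun x) (e.toFun y) (e.toFun z) := by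
  classical
  obtain ⟨-, -, -, s, hs, hx, hy, hz⟩ := id h
  exact ⟨e.injective_on_edges h.adj, e.injective_on_edges h.swap.adj,
    e.injective_on_edges h.rotate.adj, _, e.simplicial s hs, Finset.mem_image_of_mem _ hx,
    Finset.mem_image_of_mem _ hy, Finset.mem_image_of_mem _ hz⟩

theorem exists_grp_edge_iff {x y x' y' : P.Vert} (h : (oneSkeleton P.cplx).Adj x y)
    (h' : (oneSkeleton P.cplx).Adj x' y') :
    (∃ γ ∈ P.grp, γ x = x' ∧ γ y = y') ↔
      ∃ γ ∈ P'.grp, γ (e.toFun x) = e.toFun x' ∧ γ (e.toFun y) = e.toFun y' := by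
  have := e.orbits _ (edgePoint_mem_realization h) _ (edgePoint_mem_realization h')
  simp only [Pair.SameOrbit] at this
  rw [mapDomain_edgePoint e.toFun, mapDomain_edgePoint e.toFun] at this
  simpa only [mapDomain_edgePoint_eq_iff h.ne,
    mapDomain_edgePoint_eq_iff (e.injective_on_edges h)] using this

/-- The map of an extension is injective on the star of a vertex. -/
theorem eq_of_adj {x y z : P.Vert} (hy : (oneSkeleton P.cplx).Adj x y)
    (hz : (oneSkeleton P.cplx).Adj x z) (h : e.toFun y = e.toFun z) : y = z := by
  obtain ⟨γ, hγ, h1, h2⟩ := (e.exists_grp_edge_iff hy hz).2 ⟨1, P'.grp.one_mem, rfl, h⟩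
  rw [P.eq_one_of_fixes hγ h1] at h2
  exact h2

/-- The map of an extension is equivariant. -/
theorem exists_equivariant (hconn : IsConnected P.cplx) {γ : Equiv.Perm P.Vert}
    (hγ : γ ∈ P.grp) : ∃ γ' ∈ P'.grp, ∀ x, e.toFun (γ x) = γ' (e.toFun x) := by
  have hx : ∀ x, ∃ γ' ∈ P'.grp, γ' (e.toFun x) = e.toFun (γ x) := fun x =>
    e.exists_grp_vertex_iff.1 ⟨γ, hγ, rfl⟩
  choose δ hδ hδx using hx
  -- The element of Γ' given by an edge agrees, by freeness, with those chosen at its two ends;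
  -- connectedness then makes the choice constant.
  have hadj : ∀ x y, (oneSkeleton P.cplx).Adj x y → δ x = δ y := by
    intro x y hxy
    obtain ⟨γ', hγ', h1, h2⟩ := (e.exists_grp_edge_iff hxy (P.map_adj hγ hxy)).1
      ⟨γ, hγ, rfl, rfl⟩
    exact (P'.eq_of_apply_eq (hδ x) hγ' ((hδx x).trans h1.symm)).trans
      (P'.eq_of_apply_eq (hδ y) hγ' ((hδx y).trans h2.symm)).symm
  have hall : ∀ x y, δ x = δ y := by
    intro x y
    obtain ⟨w⟩ := hconn.preconnected x y
    induction w with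
    | nil => rfl
    | cons h _ ih => exact (hadj _ _ h).trans ih
  obtain ⟨x₀⟩ := hconn.nonempty
  exact ⟨δ x₀, hδ x₀, fun x => by rw [hall x₀ x, hδx]⟩

/-- An element of the group with prescribed effect upstairs and downstairs. -/
theorem exists_lift (hconn : IsConnected P.cplx) {x y : P.Vert} {γ' : Equiv.Perm P'.Vert}
    (hγ' : γ' ∈ P'.grp) (h : γ' (e.toFun x) = e.toFun y) :
    ∃ γ ∈ P.grp, γ x = y ∧ ∀ z, e.toFun (γ z) = γ' (e.toFun z) := by
  obtain ⟨γ, hγ, hxy⟩ := e.exists_grp_vertex_iff.2 ⟨γ', hγ', h⟩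
  obtain ⟨δ, hδ, hδx⟩ := e.exists_equivariant hconn hγ
  have : δ = γ' := P'.eq_of_apply_eq hδ hγ' (x := e.toFun x) (by rw [← hδx, hxy, h])
  exact ⟨γ, hγ, hxy, this ▸ hδx⟩

open Classical in
theorem face_cases {s' : Finset P'.Vert} (hs' : s' ∈ P'.cplx.faces) :
    (∃ s ∈ P.cplx.faces, s.image e.toFun = s') ∨
      ∃ i, ∃ γ ∈ P'.grp, s' = (e.C i).map γ.toEmbedding := by
  have hne : s'.Nonempty := (P'.cplx.isRelLowerSet_faces hs').1
  rcases e.covering _ (barycenter_mem_realization hs') with ⟨p, hp, hp'⟩ | h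
  · refine Or.inl ⟨p.support, hp.1, ?_⟩
    rw [← Finsupp.mapDomain_support_of_injOn, hp', support_barycenter hne]
    intro x hx y hy hxy
    by_contra hne
    exact e.injective_on_edges ⟨hne, _, hp.1, hx, hy⟩ hxy
  · rw [support_barycenter hne] at h
    exact Or.inr h

-- Two vertices of X with the same image differ by an element of Γ lying over the identity of X',
-- and this moves the face so that it passes through `x`.
open Classical in
theorem exists_face_through (hconn : IsConnected P.cplx) {s : Finset P.Vert}
    (hs : s ∈ P.cplx.faces) {x : P.Vert} (hx : e.toFun x ∈ s.image e.toFun) :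
    ∃ t ∈ P.cplx.faces, x ∈ t ∧ t.image e.toFun = s.image e.toFun := by
  obtain ⟨x', hx', hxx⟩ := Finset.mem_image.1 hx
  obtain ⟨γ, hγ, h1, h2⟩ := e.exists_lift hconn P'.grp.one_mem (x := x') (y := x) hxx
  refine ⟨s.map γ.toEmbedding, P.simplicial γ hγ s hs, ?_, ?_⟩
  · rw [← h1]
    simpa using hx'
  · rw [Finset.map_eq_image, Finset.image_image]
    exact Finset.image_congr fun y _ => h2 y

theorem three_le_card_chamber (hK : IsBuildingOfTypeTildeA2 P'.cplx)
    (i : Fin e.numMissing) (γ : Equiv.Perm P'.Vert) :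
    3 ≤ ((e.C i).map γ.toEmbedding).card := by
  classical
  obtain ⟨a, b, c, h, hC⟩ := hK.chamber (e.isChamber i)
  have : e.C i = {a, b, c} := by
    ext x
    rw [hC]
    simp
  rw [Finset.card_map, this, Finset.card_eq_three.2 ⟨a, b, c, h.1, h.2.1, h.2.2.1, rfl⟩]

theorem surjective (hK : IsBuildingOfTypeTildeA2 P'.cplx) : Function.Surjective e.toFun := by
  classical
  intro y
  rcases e.face_cases (P'.cplx.singleton_mem y) with ⟨s, -, hs⟩ | ⟨i, γ, -, hs⟩
  · have : y ∈ s.image e.toFun := by rw [hs]; simp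
    obtain ⟨x, -, hx⟩ := Finset.mem_image.1 this
    exact ⟨x, hx⟩
  · have := e.three_le_card_chamber hK i γ
    rw [← hs, Finset.card_singleton] at this
    omega

/-- The map of an extension is surjective on neighbours. -/
theorem exists_adj (hK : IsBuildingOfTypeTildeA2 P'.cplx) (hconn : IsConnected P.cplx)
    {x : P.Vert} {z' : P'.Vert}
    (h : (oneSkeleton P'.cplx).Adj (e.toFun x) z') :
    ∃ z, (oneSkeleton P.cplx).Adj x z ∧ e.toFun z = z' := by
  classical
  rcases e.face_cases (adj_iff.1 h).2 with ⟨s, hs, hs'⟩ | ⟨i, γ, -, hs⟩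
  · obtain ⟨t, ht, hx, htimage⟩ := e.exists_face_through hconn hs (x := x) (by rw [hs']; simp)
    have : z' ∈ t.image e.toFun := by rw [htimage, hs']; simp
    obtain ⟨z, hz, rfl⟩ := Finset.mem_image.1 this
    exact ⟨z, ⟨fun hxz => h.ne (by rw [hxz]), t, ht, hx, hz⟩, rfl⟩
  · have := e.three_le_card_chamber hK i γ
    rw [← hs, Finset.card_pair h.ne] at this
    omega

open Classical in
/-- A corner which is not filled in the source lies in a missing chamber. -/
theorem corner_missing (hconn : IsConnected P.cplx) {x y z : P.Vert}
    (hy : (oneSkeleton P.cplx).Adj x y) (hz : (oneSkeleton P.cplx).Adj x z)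
    (ht : Tri P'.cplx (e.toFun x) (e.toFun y) (e.toFun z)) (hn : ¬ Tri P.cplx x y z) :
    ∃ i, ∃ γ ∈ P'.grp, {e.toFun x, e.toFun y, e.toFun z} = (e.C i).map γ.toEmbedding := by
  rcases e.face_cases (tri_iff.1 ht).2.2.2 with ⟨s, hs, hs'⟩ | h
  · exfalso
    obtain ⟨t, ht', hx, htimage⟩ := e.exists_face_through hconn hs (x := x) (by rw [hs']; simp)
    rw [hs'] at htimage
    have hmem : ∀ w, (oneSkeleton P.cplx).Adj x w → e.toFun w ∈ t.image e.toFun → w ∈ t := by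
      intro w hw hwt
      obtain ⟨w', hw', hww⟩ := Finset.mem_image.1 hwt
      have hne : x ≠ w' := fun h => e.injective_on_edges hw (by rw [h, hww])
      rwa [e.eq_of_adj hw ⟨hne, t, ht', hx, hw'⟩ hww.symm]
    refine hn ⟨hy.ne, hz.ne, fun h => ht.2.2.1 (by rw [h]), t, ht', hx, hmem y hy ?_, hmem z hz ?_⟩
    · rw [htimage]; simp
    · rw [htimage]; simp
  · exact h

/-- Any two missing corners are equivalent when there is a single missing chamber. -/
theorem exists_grp_of_missing (hconn : IsConnected P.cplx) (hn : e.numMissing = 1)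
    {x y z x' y' z' : P.Vert}
    (hy : (oneSkeleton P.cplx).Adj x y) (hz : (oneSkeleton P.cplx).Adj x z)
    (ht : Tri P'.cplx (e.toFun x) (e.toFun y) (e.toFun z)) (hm : ¬ Tri P.cplx x y z)
    (hy' : (oneSkeleton P.cplx).Adj x' y') (hz' : (oneSkeleton P.cplx).Adj x' z')
    (ht' : Tri P'.cplx (e.toFun x') (e.toFun y') (e.toFun z')) (hm' : ¬ Tri P.cplx x' y' z') :
    ∃ γ ∈ P'.grp, ∀ v, (v = e.toFun x ∨ v = e.toFun y ∨ v = e.toFun z) →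
      (γ v = e.toFun x' ∨ γ v = e.toFun y' ∨ γ v = e.toFun z') := by
  classical
  obtain ⟨i, γ, hγ, h⟩ := e.corner_missing hconn hy hz ht hm
  obtain ⟨j, δ, hδ, h'⟩ := e.corner_missing hconn hy' hz' ht' hm'
  have hij : i = j := by
    have : Subsingleton (Fin e.numMissing) := by rw [hn]; infer_instance
    exact Subsingleton.elim i j
  subst hij
  refine ⟨δ * γ⁻¹, P'.grp.mul_mem hδ (P'.grp.inv_mem hγ), fun v hv => ?_⟩
  have hv' : v ∈ ({e.toFun x, e.toFun y, e.toFun z} : Finset _) := by simpa using hv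
  rw [h, Finset.mem_map] at hv'
  obtain ⟨c, hc, rfl⟩ := hv'
  have : δ c ∈ (e.C i).map δ.toEmbedding := by simpa using hc
  rw [← h'] at this
  simpa using this

end Extension

/-! ### Links of vertices as partial projective planes -/

section Links

variable {P : Pair.{u}} {P' : Pair.{v}} (e : Extension P P')

/-- The neighbours of a vertex. -/
abbrev LinkVert (P : Pair.{u}) (x : P.Vert) : Type u := {y // (oneSkeleton P.cplx).Adj x y}

/-- Adjacency in the link of `x`. -/
def linkAdj (P : Pair.{u}) (x : P.Vert) (y z : LinkVert P x) : Prop := Tri P.cplx x y z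

/-- Adjacency in the link of the image of `x`. -/
def Extension.linkAdj (x : P.Vert) (y z : LinkVert P x) : Prop :=
  Tri P'.cplx (e.toFun x) (e.toFun y) (e.toFun z)

open Classical in
/-- The color of a neighbour of `x`, from the type of its image. -/
noncomputable def Extension.linkColor (τ : P'.Vert → ZMod 3) (x : P.Vert) (y : LinkVert P x) :
    Bool :=
  decide (τ (e.toFun y) = τ (e.toFun x) + 1)

theorem type_eq_iff : ∀ a b c : ZMod 3, a ≠ b → a ≠ c → (b = c ↔ (b = a + 1 ↔ c = a + 1)) := by
  decide

/-- The neighbours of `x` correspond bijectively to those of its image. Their images take only the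
two types other than that of the image of `x`, which gives the coloring. -/
theorem Extension.isIncidenceGraph (hK : IsBuildingOfTypeTildeA2 P'.cplx)
    (hconn : IsConnected P.cplx) (x : P.Vert) :
    ∃ κ, IsIncidenceGraph (e.linkAdj x) κ := by
  obtain ⟨τ, hτ⟩ := hK.exists_type
  have hcolor : ∀ y z : LinkVert P x, e.linkColor τ x y = e.linkColor τ x z ↔
      τ (e.toFun y) = τ (e.toFun z) := by
    intro y z
    rw [type_eq_iff _ _ _ (hτ _ _ (e.map_adj y.2)) (hτ _ _ (e.map_adj z.2))]
    simp [Extension.linkColor]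
  refine ⟨e.linkColor τ x, fun h => h.swap, fun {a b} h => ?_, fun {a b} hab hc => ?_⟩
  · rw [Ne, hcolor]
    exact hτ _ _ h.rotate.adj
  · have hne : e.toFun a ≠ e.toFun b := fun h => hab (Subtype.ext (e.eq_of_adj a.2 b.2 h))
    obtain ⟨u, ⟨hu1, hu2⟩, hu⟩ := hK.existsUnique_common_neighbor hτ (e.map_adj a.2)
      (e.map_adj b.2) hne ((hcolor a b).1 hc)
    obtain ⟨c, hc, rfl⟩ := e.exists_adj hK hconn hu1.swap.adj
    refine ⟨⟨c, hc⟩, ⟨hu1, hu2⟩, ?_⟩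
    rintro ⟨c', hc'⟩ h'
    exact Subtype.ext (e.eq_of_adj hc' hc (hu _ h'))

theorem exists_two_triangles (hbd : HasNoBoundary P.cplx)
    {x y : P.Vert} (h : (oneSkeleton P.cplx).Adj x y) :
    ∃ z z', z ≠ z' ∧ Tri P.cplx x y z ∧ Tri P.cplx x y z' := by
  classical
  obtain ⟨hne, hs⟩ := adj_iff.1 h
  obtain ⟨t, ht, t', ht', htt, hc, hc', hst, hst'⟩ := hbd _ hs (Finset.card_pair hne)
  have third : ∀ t ∈ P.cplx.faces, t.card = 3 → {x, y} ⊆ t →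
      ∃ z, Tri P.cplx x y z ∧ t = {x, y, z} := by
    intro t ht hc hst
    obtain ⟨z, hz, hz'⟩ := Finset.exists_mem_notMem_of_card_lt_card (s := {x, y}) (t := t)
      (by rw [hc, Finset.card_pair hne]; omega)
    simp only [Finset.mem_insert, Finset.mem_singleton, not_or] at hz'
    simp only [Finset.insert_subset_iff, Finset.singleton_subset_iff] at hst
    have h3 : ({x, y, z} : Finset P.Vert).card = 3 :=
      Finset.card_eq_three.2 ⟨x, y, z, hne, Ne.symm hz'.1, Ne.symm hz'.2, rfl⟩
    refine ⟨z, ⟨hne, Ne.symm hz'.1, Ne.symm hz'.2, t, ht, hst.1, hst.2, hz⟩, ?_⟩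
    refine (Finset.eq_of_subset_of_card_le ?_ (by rw [hc, h3])).symm
    simp [Finset.insert_subset_iff, hst.1, hst.2, hz]
  obtain ⟨z, hz, rfl⟩ := third t ht hc hst
  obtain ⟨z', hz', rfl⟩ := third t' ht' hc' hst'
  exact ⟨z, z', fun h => htt (by rw [h]), hz, hz'⟩

theorem exists_eq_of_four_of_three {α : Type u} {a b c x y z w : α} (hx : x = a ∨ x = b ∨ x = c)
    (hy : y = a ∨ y = b ∨ y = c) (hz : z = a ∨ z = b ∨ z = c) (hw : w = a ∨ w = b ∨ w = c) :
    x = y ∨ x = z ∨ x = w ∨ y = z ∨ y = w ∨ z = w := by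
  grind

theorem Extension.isNearlyFull (hK : IsBuildingOfTypeTildeA2 P'.cplx)
    (hconn : IsConnected P.cplx) (hbd : HasNoBoundary P.cplx) (hn : e.numMissing = 1) (x : P.Vert) :
    IsNearlyFull (ChambersMissing.linkAdj P x) (e.linkAdj x) := by
  classical
  refine ⟨fun h => h.swap, fun h => e.map_tri h, fun y => ?_, ?_⟩
  · obtain ⟨z, z', hne, hz, hz'⟩ := exists_two_triangles hbd y.2
    exact ⟨⟨z, hz.swap.adj⟩, ⟨z', hz'.swap.adj⟩, fun h => hne (congrArg Subtype.val h), hz, hz'⟩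
  · have hsub : Subsingleton (Fin e.numMissing) := by rw [hn]; infer_instance
    let i : Fin e.numMissing := ⟨0, by omega⟩
    obtain ⟨c₁, c₂, c₃, -, hC⟩ := hK.chamber (e.isChamber i)
    have pos : ∀ y z : LinkVert P x, e.linkAdj x y z → ¬ ChambersMissing.linkAdj P x y z →
        ∃ v, (v = c₁ ∨ v = c₂ ∨ v = c₃) ∧ ∃ γ ∈ P'.grp, γ v = e.toFun x ∧
          {e.toFun x, e.toFun y, e.toFun z} = (e.C i).map γ.toEmbedding := by
      intro y z h h'
      obtain ⟨j, γ, hγ, hj⟩ := e.corner_missing hconn y.2 z.2 h h'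
      rw [Subsingleton.elim j i] at hj
      have hx : e.toFun x ∈ (e.C i).map γ.toEmbedding := by rw [← hj]; simp
      obtain ⟨v, hv, hvx⟩ := Finset.mem_map.1 hx
      exact ⟨v, (hC v).1 hv, γ, hγ, hvx, hj⟩
    -- By freeness, the vertex `v` of the missing chamber that is sent to the image of `x`
    -- determines the group element, hence the translated chamber and the missing edge.
    have same : ∀ y z y' z' : LinkVert P x, e.linkAdj x y z → e.linkAdj x y' z' → ∀ v v',
        (∃ γ ∈ P'.grp, γ v = e.toFun x ∧
          {e.toFun x, e.toFun y, e.toFun z} = (e.C i).map γ.toEmbedding) →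
        (∃ γ ∈ P'.grp, γ v' = e.toFun x ∧
          {e.toFun x, e.toFun y', e.toFun z'} = (e.C i).map γ.toEmbedding) →
        v = v' → s(y, z) = s(y', z') := by
      rintro y z y' z' h h' v _ ⟨γ, hγ, hv, hs⟩ ⟨γ', hγ', hv', hs'⟩ rfl
      rw [P'.eq_of_apply_eq hγ hγ' (hv.trans hv'.symm), ← hs'] at hs
      have inj : ∀ a b : LinkVert P x, e.toFun a = e.toFun b → a = b := fun a b hab =>
        Subtype.ext (e.eq_of_adj a.2 b.2 hab)
      have hy : e.toFun y ∈ ({e.toFun x, e.toFun y', e.toFun z'} : Finset _) := by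
        rw [← hs]; simp
      have hz : e.toFun z ∈ ({e.toFun x, e.toFun y', e.toFun z'} : Finset _) := by
        rw [← hs]; simp
      simp only [Finset.mem_insert, Finset.mem_singleton, h.1.symm, h.2.1.symm, false_or] at hy hz
      have hyz := h.2.2.1
      rw [Sym2.eq_iff]
      rcases hy with hy | hy <;> rcases hz with hz | hz
      · exact absurd (hy.trans hz.symm) hyz
      · exact Or.inl ⟨inj _ _ hy, inj _ _ hz⟩
      · exact Or.inr ⟨inj _ _ hy, inj _ _ hz⟩
      · exact absurd (hy.trans hz.symm) hyz
    intro a b c d a' b' c' d' ha ha' hb hb' hc hc' hd hd'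
    obtain ⟨v₁, hv₁, h₁⟩ := pos a a' ha ha'
    obtain ⟨v₂, hv₂, h₂⟩ := pos b b' hb hb'
    obtain ⟨v₃, hv₃, h₃⟩ := pos c c' hc hc'
    obtain ⟨v₄, hv₄, h₄⟩ := pos d d' hd hd'
    exact (exists_eq_of_four_of_three hv₁ hv₂ hv₃ hv₄).imp (same _ _ _ _ ha hb _ _ h₁ h₂)
      (Or.imp (same _ _ _ _ ha hc _ _ h₁ h₃) (Or.imp (same _ _ _ _ ha hd _ _ h₁ h₄)
        (Or.imp (same _ _ _ _ hb hc _ _ h₂ h₃) (Or.imp (same _ _ _ _ hb hd _ _ h₂ h₄)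
          (same _ _ _ _ hc hd _ _ h₃ h₄)))))

end Links

/-! ### Comparison of two extensions -/

section Comparison

variable {P : Pair.{u}} {P₀ : Pair.{v}} {P₁ : Pair.{w}}

/-- Two extensions fill the same corners. -/
def SameCorners (e₀ : Extension P P₀) (e₁ : Extension P P₁) : Prop :=
  ∀ x y z, (oneSkeleton P.cplx).Adj x y → (oneSkeleton P.cplx).Adj x z →
    (Tri P₀.cplx (e₀.toFun x) (e₀.toFun y) (e₀.toFun z) ↔
      Tri P₁.cplx (e₁.toFun x) (e₁.toFun y) (e₁.toFun z))

theorem sameCorners (hconn : IsConnected P.cplx) (hbd : HasNoBoundary P.cplx) {e₀ : Extension P P₀} {e₁ : Extension P P₁}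
    (hK₀ : IsBuildingOfTypeTildeA2 P₀.cplx) (hK₁ : IsBuildingOfTypeTildeA2 P₁.cplx)
    (hn : e₀.numMissing = 1) : SameCorners e₀ e₁ := by
  intro x y z hy hz
  obtain ⟨κ, hκ⟩ := e₀.isIncidenceGraph hK₀ hconn x
  obtain ⟨κ₁, hκ₁⟩ := e₁.isIncidenceGraph hK₁ hconn x
  exact (e₀.isNearlyFull hK₀ hconn hbd hn x).completion_unique hκ (fun h => e₁.map_tri h) hκ₁
    ⟨y, hy⟩ ⟨z, hz⟩

/-- The corners of the chambers filled by `e₀` are matched in the same way by `e₁`. -/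
def SameMatching (e₀ : Extension P P₀) (e₁ : Extension P P₁) : Prop :=
  ∀ x y z t, (oneSkeleton P.cplx).Adj x y → (oneSkeleton P.cplx).Adj x z →
    Tri P₀.cplx (e₀.toFun x) (e₀.toFun y) (e₀.toFun z) → (oneSkeleton P.cplx).Adj y t →
    e₀.toFun t = e₀.toFun z → e₁.toFun t = e₁.toFun z

/-- Continue the corner at `x` to `y` as `e₁` does, reaching `t₁`. If `e₀` disagrees, the image
under `e₀` of y, x, t₁ is a second missing chamber on the edge from `x` to `y`, and some `g` carries
the first chamber to it. -/
theorem SameCorners.sameMatching {e₀ : Extension P P₀} {e₁ : Extension P P₁}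
    (hc : SameCorners e₀ e₁) (hconn : IsConnected P.cplx)
    (hK₁ : IsBuildingOfTypeTildeA2 P₁.cplx) (hn : e₀.numMissing = 1) : SameMatching e₀ e₁ := by
  intro x y z t hy hz ht hyt h₀
  by_cases hxyz : Tri P.cplx x y z
  · rw [e₀.eq_of_adj hyt hxyz.rotate.adj h₀]
  have htμ := (hc x y z hy hz).1 ht
  obtain ⟨t₁, ht₁, hm₁⟩ := e₁.exists_adj hK₁ hconn htμ.rotate.adj
  have c₁ : Tri P₀.cplx (e₀.toFun y) (e₀.toFun x) (e₀.toFun t₁) :=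
    (hc y x t₁ hy.symm ht₁).2 (by rw [hm₁]; exact htμ.rotate.swap)
  have m₁ : ¬ Tri P.cplx y x t₁ := by
    intro h
    rw [← e₁.eq_of_adj hz h.rotate.adj hm₁.symm] at h
    exact hxyz h.rotate.swap
  by_cases hd : e₀.toFun t₁ = e₀.toFun z
  · rw [e₀.eq_of_adj hyt ht₁ (h₀.trans hd.symm), hm₁]
  exfalso
  obtain ⟨g, hg, hgv⟩ := e₀.exists_grp_of_missing hconn hn hy hz ht hxyz hy.symm ht₁ c₁ m₁
  have hg1 : g ≠ 1 := by
    rintro rfl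
    rcases hgv _ (Or.inr (Or.inr rfl)) with h | h | h
    · exact ht.2.2.1 h.symm
    · exact ht.2.1 h.symm
    · exact hd h.symm
  have fix : ∀ v, g v ≠ v := fun v h => hg1 (P₀.eq_one_of_fixes hg h)
  have swap : g (e₀.toFun x) = e₀.toFun y → g (e₀.toFun y) ≠ e₀.toFun x := fun h h' =>
    P₀.not_swap hg ht.adj h h'
  have ga := hgv _ (Or.inr (Or.inr rfl))
  have gb := hgv _ (Or.inl rfl)
  have gc := hgv _ (Or.inr (Or.inl rfl))
  have nab : g (e₀.toFun z) ≠ g (e₀.toFun x) := fun h => ht.2.1 (g.injective h).symm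
  have nac : g (e₀.toFun z) ≠ g (e₀.toFun y) := fun h => ht.2.2.1 (g.injective h).symm
  have nbc : g (e₀.toFun x) ≠ g (e₀.toFun y) := fun h => ht.1 (g.injective h)
  have fb := fix (e₀.toFun x)
  have fc := fix (e₀.toFun y)
  -- No vertex is fixed and the common edge is not flipped, so `g` sends either z, x, y to x, y, t₁,
  -- or z, y, x to y, x, t₁.
  have cases : (g (e₀.toFun z) = e₀.toFun x ∧ g (e₀.toFun x) = e₀.toFun y ∧
      g (e₀.toFun y) = e₀.toFun t₁) ∨ (g (e₀.toFun z) = e₀.toFun y ∧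
      g (e₀.toFun y) = e₀.toFun x ∧ g (e₀.toFun x) = e₀.toFun t₁) := by
    grind
  rcases cases with ⟨ha, hb, hc'⟩ | ⟨ha, hc', hb⟩
  -- Lifted to X and pushed to the other building, where `t₁` and `z` coincide, `g` rotates a
  -- triangle.
  · obtain ⟨h, hh, hxy, hhv⟩ := e₀.exists_lift hconn hg hb
    have e1 : h y = t₁ := e₀.eq_of_adj (x := y) (by
      have := P.map_adj hh hy
      rwa [hxy] at this) ht₁ (by rw [hhv, hc'])
    have e2 : h z = x := e₀.eq_of_adj (x := y) (by
      have := P.map_adj hh hz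
      rwa [hxy] at this) hy.symm (by rw [hhv, ha])
    obtain ⟨k, hk, hkv⟩ := e₁.exists_equivariant hconn hh
    exact P₁.not_rotate hk htμ.rotate.rotate (by rw [← hkv, e2]) (by rw [← hkv, hxy])
      (by rw [← hkv, e1, hm₁])
  -- In the other case, compare the matching along the edge from `x` to `z` too: `t₂` plays there
  -- the role of `t₁`.
  · obtain ⟨t₂, ht₂, hm₂⟩ := e₁.exists_adj hK₁ hconn htμ.rotate.swap.rotate.rotate.adj
    have hzx := hz.symm
    have c₂ : Tri P₀.cplx (e₀.toFun z) (e₀.toFun x) (e₀.toFun t₂) :=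
      (hc z x t₂ hzx ht₂).2 (by rw [hm₂]; exact htμ.rotate.rotate)
    have m₂ : ¬ Tri P.cplx z x t₂ := by
      intro h
      rw [e₁.eq_of_adj h.rotate.adj hy hm₂] at h
      exact hxyz h.rotate
    by_cases hd' : e₀.toFun t₂ = e₀.toFun y
    -- The oriented edges from `z` to `t₂` and from `t₁` to `y` have the same image under `e₁`, so
    -- their images under `e₀` are equivalent. These share their end, hence coincide by freeness.
    · obtain ⟨δ, hδ, hδ1, hδ2⟩ := (e₀.exists_grp_edge_iff ht₂ ht₁.symm).1
        ((e₁.exists_grp_edge_iff ht₂ ht₁.symm).2 ⟨1, P₁.grp.one_mem, hm₁.symm, hm₂⟩)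
      rw [P₀.eq_one_of_fixes hδ (hδ2.trans hd'.symm)] at hδ1
      exact hd hδ1.symm
    · obtain ⟨k, hk, hkv⟩ := e₀.exists_grp_of_missing hconn hn hy hz ht hxyz hzx ht₂ c₂ m₂
      have hk1 : k ≠ 1 := by
        rintro rfl
        rcases hkv _ (Or.inr (Or.inl rfl)) with h | h | h
        · exact ht.2.2.1 h
        · exact ht.1 h.symm
        · exact hd' h.symm
      have kfix : ∀ v, k v ≠ v := fun v h => hk1 (P₀.eq_one_of_fixes hk h)
      have kswap : k (e₀.toFun z) = e₀.toFun x → k (e₀.toFun x) ≠ e₀.toFun z := fun h h' =>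
        P₀.not_swap hk ht.rotate.rotate.adj h h'
      have ka := hkv _ (Or.inr (Or.inr rfl))
      have kb := hkv _ (Or.inl rfl)
      have kc := hkv _ (Or.inr (Or.inl rfl))
      have kab : k (e₀.toFun z) ≠ k (e₀.toFun x) := fun h => ht.2.1 (k.injective h).symm
      have kac : k (e₀.toFun z) ≠ k (e₀.toFun y) := fun h => ht.2.2.1 (k.injective h).symm
      have kbc : k (e₀.toFun x) ≠ k (e₀.toFun y) := fun h => ht.1 (k.injective h)
      have fa' := kfix (e₀.toFun z)
      have fb' := kfix (e₀.toFun x)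
      -- The same analysis leaves two possibilities for `k`. By freeness they force `k * g = 1` or
      -- `k = g`, and either would give `t₁` and `z` the same image under `e₀`.
      have cases : (k (e₀.toFun z) = e₀.toFun x ∧ k (e₀.toFun y) = e₀.toFun z) ∨
          (k (e₀.toFun x) = e₀.toFun z ∧ k (e₀.toFun y) = e₀.toFun x) := by
        grind
      rcases cases with ⟨h1, h2⟩ | ⟨h1, h2⟩
      · have hkg : k * g = 1 := P₀.eq_one_of_fixes (P₀.grp.mul_mem hk hg) (x := e₀.toFun z)
          (by simp [ha, h2])
        have h3 : k (g (e₀.toFun x)) = e₀.toFun x := by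
          rw [← Equiv.Perm.mul_apply, hkg]
          rfl
        rw [hb, ← h1] at h3
        exact hd (k.injective h3)
      · have hkg : k = g := P₀.eq_of_apply_eq hk hg (x := e₀.toFun y) (by rw [h2, hc'])
        rw [hkg, hb] at h1
        exact hd h1

theorem SameCorners.symm {e₀ : Extension P P₀} {e₁ : Extension P P₁}
    (hc : SameCorners e₀ e₁) : SameCorners e₁ e₀ :=
  fun x y z hy hz => (hc x y z hy hz).symm

theorem SameMatching.symm {e₀ : Extension P P₀} {e₁ : Extension P P₁}
    (hm : SameMatching e₀ e₁) (hc : SameCorners e₀ e₁) (hconn : IsConnected P.cplx)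
    (hK₀ : IsBuildingOfTypeTildeA2 P₀.cplx) : SameMatching e₁ e₀ := by
  intro x y z t hy hz ht hyt h₁
  have ht' := (hc x y z hy hz).2 ht
  obtain ⟨s, hs, h₀⟩ := e₀.exists_adj hK₀ hconn ht'.rotate.adj
  have := hm x y z s hy hz ht' hs h₀
  rw [← h₀, e₁.eq_of_adj hyt hs (h₁.trans this.symm)]

/-- The element of Γ taking `x'` to `x` lies over the identity of both targets, so it transports
neighbours without changing either image. -/
theorem exists_adj_of_eq_of_eq (hconn : IsConnected P.cplx) (e₀ : Extension P P₀)
    (e₁ : Extension P P₁) {x x' y' : P.Vert} (h₀ : e₀.toFun x' = e₀.toFun x)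
    (h₁ : e₁.toFun x' = e₁.toFun x) (h : (oneSkeleton P.cplx).Adj x' y') :
    ∃ y, (oneSkeleton P.cplx).Adj x y ∧ e₀.toFun y = e₀.toFun y' ∧ e₁.toFun y = e₁.toFun y' := by
  obtain ⟨γ, hγ, hx, hγ₀⟩ := e₀.exists_lift hconn P₀.grp.one_mem h₀
  obtain ⟨δ, hδ, hδ₁⟩ := e₁.exists_equivariant hconn hγ
  have : δ = 1 := P₁.eq_one_of_fixes hδ (x := e₁.toFun x') (by rw [← hδ₁, hx, h₁])
  refine ⟨γ y', by rw [← hx]; exact P.map_adj hγ h, hγ₀ y', ?_⟩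
  rw [hδ₁, this]
  rfl

/-- Points of the source with the same image in one building have the same image in the other
one. -/
theorem SameMatching.eq_of_eq {e₀ : Extension P P₀} {e₁ : Extension P P₁}
    (hm : SameMatching e₀ e₁) (hconn : IsConnected P.cplx)
    (hK₀ : IsBuildingOfTypeTildeA2 P₀.cplx) {x y : P.Vert} (h : e₀.toFun x = e₀.toFun y) :
    e₁.toFun x = e₁.toFun y := by
  -- The graph of pairs of images covers the 1-skeleton of the first building; `SameMatching` is
  -- what makes triangles lift.
  let T := {q : P₀.Vert × P₁.Vert // ∃ x, q = (e₀.toFun x, e₁.toFun x)}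
  let R : T → T → Prop := fun t t' => ∃ x y, (oneSkeleton P.cplx).Adj x y ∧
    t.1 = (e₀.toFun x, e₁.toFun x) ∧ t'.1 = (e₀.toFun y, e₁.toFun y)
  let mk : P.Vert → T := fun x => ⟨(e₀.toFun x, e₁.toFun x), x, rfl⟩
  have mk_eq : ∀ t : T, ∃ x, t = mk x := fun ⟨q, x, hx⟩ => ⟨x, Subtype.ext hx⟩
  have R_iff : ∀ x t, R (mk x) t ↔ ∃ y, (oneSkeleton P.cplx).Adj x y ∧ t = mk y := by
    intro x t
    constructor
    · rintro ⟨x', y', hxy, h1, h2⟩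
      obtain ⟨y, hy, hy₀, hy₁⟩ := exists_adj_of_eq_of_eq hconn e₀ e₁ (x := x)
        (congrArg Prod.fst h1).symm (congrArg Prod.snd h1).symm hxy
      refine ⟨y, hy, Subtype.ext ?_⟩
      rw [h2, ← hy₀, ← hy₁]
    · rintro ⟨y, hxy, rfl⟩
      exact ⟨x, y, hxy, rfl, rfl⟩
  have hinj : Function.Injective (fun t : T => t.1.1) := by
    refine hK₀.injective_of_covering (fun t : T => t.1.1) R ?_ ?_ ?_ ?_ ?_ ?_
    · rintro t t' ⟨x, y, hxy, h1, h2⟩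
      exact ⟨y, x, hxy.symm, h2, h1⟩
    · rintro t t' ⟨x, y, hxy, h1, h2⟩
      simp only [h1, h2]
      exact e₀.map_adj hxy
    · intro t z hz
      obtain ⟨x, rfl⟩ := mk_eq t
      obtain ⟨y, hy, rfl⟩ := e₀.exists_adj hK₀ hconn hz
      exact ⟨mk y, (R_iff _ _).2 ⟨y, hy, rfl⟩, rfl⟩
    · intro t t' t'' h1 h2 heq
      obtain ⟨x, rfl⟩ := mk_eq t
      obtain ⟨y, hy, rfl⟩ := (R_iff _ _).1 h1
      obtain ⟨z, hz, rfl⟩ := (R_iff _ _).1 h2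
      rw [e₀.eq_of_adj hy hz heq]
    · intro t t' t'' h1 h2 htri
      obtain ⟨x, rfl⟩ := mk_eq t
      obtain ⟨y, hy, rfl⟩ := (R_iff _ _).1 h1
      obtain ⟨z, hz, rfl⟩ := (R_iff _ _).1 h2
      have htri' : Tri P₀.cplx (e₀.toFun x) (e₀.toFun y) (e₀.toFun z) := htri
      obtain ⟨s, hs, hsz⟩ := e₀.exists_adj hK₀ hconn htri'.rotate.adj
      refine (R_iff _ _).2 ⟨s, hs, Subtype.ext (Prod.ext hsz.symm ?_)⟩
      exact (hm x y z s hy hz htri' hs hsz).symm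
    · intro t t'
      obtain ⟨x, rfl⟩ := mk_eq t
      obtain ⟨y, rfl⟩ := mk_eq t'
      obtain ⟨w⟩ := hconn.preconnected x y
      induction w with
      | nil => exact Relation.ReflTransGen.refl
      | cons h _ ih => exact Relation.ReflTransGen.head ((R_iff _ _).2 ⟨_, h, rfl⟩) ih
  have : mk x = mk y := hinj h
  exact congrArg (fun t : T => t.1.2) this

/-- Two extensions with the same identifications and the same filled corners. -/
structure Compatible (e₀ : Extension P P₀) (e₁ : Extension P P₁) : Prop where
  corners : SameCorners e₀ e₁
  eq_iff : ∀ x y, e₀.toFun x = e₀.toFun y ↔ e₁.toFun x = e₁.toFun y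

theorem compatible (hconn : IsConnected P.cplx) (hbd : HasNoBoundary P.cplx) {e₀ : Extension P P₀} {e₁ : Extension P P₁}
    (hK₀ : IsBuildingOfTypeTildeA2 P₀.cplx) (hK₁ : IsBuildingOfTypeTildeA2 P₁.cplx)
    (hn : e₀.numMissing = 1) : Compatible e₀ e₁ := by
  have hc : SameCorners e₀ e₁ := sameCorners hconn hbd hK₀ hK₁ hn
  have hm := hc.sameMatching hconn hK₁ hn
  have hm' := hm.symm hc hconn hK₀
  exact ⟨hc, fun x y => ⟨hm.eq_of_eq hconn hK₀, hm'.eq_of_eq hconn hK₁⟩⟩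

theorem Compatible.symm {e₀ : Extension P P₀} {e₁ : Extension P P₁} (h : Compatible e₀ e₁) :
    Compatible e₁ e₀ :=
  ⟨h.corners.symm, fun x y => (h.eq_iff x y).symm⟩

theorem Compatible.trans {P₂ : Pair.{z}} {e₀ : Extension P P₀} {e₁ : Extension P P₁}
    {e₂ : Extension P P₂} (h : Compatible e₀ e₁) (h' : Compatible e₁ e₂) : Compatible e₀ e₂ :=
  ⟨fun x y z hy hz => (h.corners x y z hy hz).trans (h'.corners x y z hy hz),
    fun x y => (h.eq_iff x y).trans (h'.eq_iff x y)⟩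

/-- The identity of a pair. -/
def PairIso.refl (P : Pair.{u}) : PairIso P P where
  toEquiv := Equiv.refl _
  faces_iff s := by simp
  equivariant _ := Iff.rfl

/-- A face either comes from X or is a missing chamber; in the latter case its corner at a preimage
of a vertex is also filled by `e₁`. -/
theorem Compatible.map_mem_faces {e₀ : Extension P P₀} {e₁ : Extension P P₁}
    (h : Compatible e₀ e₁) (hconn : IsConnected P.cplx)
    (hK₀ : IsBuildingOfTypeTildeA2 P₀.cplx) {θ : P₀.Vert ≃ P₁.Vert}
    (hθ : ∀ x, θ (e₀.toFun x) = e₁.toFun x) {s : Finset P₀.Vert} (hs : s ∈ P₀.cplx.faces) :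
    s.map θ.toEmbedding ∈ P₁.cplx.faces := by
  classical
  rcases e₀.face_cases hs with ⟨t, ht, rfl⟩ | ⟨i, γ, hγ, hsγ⟩
  · rw [Finset.map_eq_image, Finset.image_image]
    have : t.image (θ.toEmbedding ∘ e₀.toFun) = t.image e₁.toFun :=
      Finset.image_congr fun x _ => hθ x
    rw [this]
    exact e₁.simplicial t ht
  · obtain ⟨a, b, c, habc, hC⟩ := hK₀.chamber (e₀.isChamber i)
    have hγtri := P₀.map_tri hγ habc
    have hs3 : s = {γ a, γ b, γ c} := by
      rw [hsγ]
      have : e₀.C i = {a, b, c} := by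
        ext x
        rw [hC]
        simp
      rw [this]
      simp
    obtain ⟨x, hx⟩ := e₀.surjective hK₀ (γ a)
    rw [← hx] at hγtri hs3
    obtain ⟨y, hxy, hy⟩ := e₀.exists_adj hK₀ hconn hγtri.adj
    obtain ⟨z, hxz, hz⟩ := e₀.exists_adj hK₀ hconn hγtri.swap.adj
    rw [← hy, ← hz] at hγtri hs3
    have := (tri_iff.1 ((h.corners x y z hxy hxz).1 hγtri)).2.2.2
    rw [hs3]
    simpa [hθ] using this

/-- An element of the first target group lifts to Γ and descends to the second target group;
surjectivity on vertices shows that the result is the conjugate by `θ`. -/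
theorem Compatible.permCongr_mem {e₀ : Extension P P₀} {e₁ : Extension P P₁}
    (hconn : IsConnected P.cplx) (hK₀ : IsBuildingOfTypeTildeA2 P₀.cplx)
    (hK₁ : IsBuildingOfTypeTildeA2 P₁.cplx) {θ : P₀.Vert ≃ P₁.Vert}
    (hθ : ∀ x, θ (e₀.toFun x) = e₁.toFun x) {γ : Equiv.Perm P₀.Vert} (hγ : γ ∈ P₀.grp) :
    θ.permCongr γ ∈ P₁.grp := by
  obtain ⟨x⟩ := hconn.nonempty
  obtain ⟨y, hy⟩ := e₀.surjective hK₀ (γ (e₀.toFun x))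
  obtain ⟨δ, hδ, -, hδ₀⟩ := e₀.exists_lift hconn hγ hy.symm
  obtain ⟨γ₁, hγ₁, hδ₁⟩ := e₁.exists_equivariant hconn hδ
  have : θ.permCongr γ = γ₁ := by
    ext v
    obtain ⟨x, rfl⟩ := e₁.surjective hK₁ v
    rw [Equiv.permCongr_apply, ← hθ, Equiv.symm_apply_apply, ← hδ₀, hθ, hδ₁, hθ]
  rwa [this]

theorem Compatible.exists_iso {e₀ : Extension P P₀} {e₁ : Extension P P₁}
    (h : Compatible e₀ e₁) (hconn : IsConnected P.cplx)
    (hK₀ : IsBuildingOfTypeTildeA2 P₀.cplx) (hK₁ : IsBuildingOfTypeTildeA2 P₁.cplx) :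
    ∃ φ : ExtensionIso e₀ e₁, ∀ x, φ.θ.toEquiv x = x := by
  choose a ha using e₀.surjective hK₀
  choose b hb using e₁.surjective hK₁
  let θ : P₀.Vert ≃ P₁.Vert :=
    { toFun := fun v => e₁.toFun (a v)
      invFun := fun v => e₀.toFun (b v)
      left_inv := fun v => by
        change e₀.toFun (b (e₁.toFun (a v))) = v
        rw [(h.eq_iff (b (e₁.toFun (a v))) (a v)).2 (hb _), ha]
      right_inv := fun v => by
        change e₁.toFun (a (e₀.toFun (b v))) = v
        rw [(h.eq_iff (a (e₀.toFun (b v))) (b v)).1 (ha _), hb] }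
  have hθ : ∀ x, θ (e₀.toFun x) = e₁.toFun x := fun x => (h.eq_iff _ _).1 (ha _)
  have hθ' : ∀ x, θ.symm (e₁.toFun x) = e₀.toFun x := fun x => by
    rw [Equiv.symm_apply_eq, hθ]
  refine ⟨⟨PairIso.refl P, ⟨θ, fun s => ⟨h.map_mem_faces hconn hK₀ hθ, fun hs => ?_⟩,
    fun γ => ⟨permCongr_mem hconn hK₀ hK₁ hθ, fun hγ => ?_⟩⟩, hθ⟩, fun x => rfl⟩
  · have := h.symm.map_mem_faces hconn hK₁ hθ' hs
    rwa [Finset.map_map, ← Equiv.trans_toEmbedding, Equiv.self_trans_symm,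
      Equiv.refl_toEmbedding, Finset.map_refl] at this
  · have := permCongr_mem hconn hK₁ hK₀ hθ' hγ
    have h2 : θ.symm.permCongr (θ.permCongr γ) = γ := by
      ext v
      simp [Equiv.permCongr_apply]
    rwa [h2] at this

end Comparison

end ChambersMissing

theorem mainTheorem4 (P : ChambersMissing.Pair.{u})
    (hP : ChambersMissing.IsBuildingOfTypeTildeA2WithChambersMissing P 1) :
    (∃ (P' : ChambersMissing.Pair.{u}) (_ : ChambersMissing.Extension P P'),
      ChambersMissing.IsBuildingOfTypeTildeA2 P'.cplx) ∧
    ∀ (P₀' : ChambersMissing.Pair.{v}) (P₁' : ChambersMissing.Pair.{w})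
      (e₀ : ChambersMissing.Extension P P₀') (e₁ : ChambersMissing.Extension P P₁'),
      ChambersMissing.IsBuildingOfTypeTildeA2 P₀'.cplx →
      ChambersMissing.IsBuildingOfTypeTildeA2 P₁'.cplx →
        ∃ φ : ChambersMissing.ExtensionIso e₀ e₁, ∀ x, φ.θ.toEquiv x = x := by
  obtain ⟨hconn, -, hbd, P', e, hK, hn⟩ := hP
  refine ⟨⟨P', e, hK⟩, fun P₀' P₁' e₀ e₁ hK₀ hK₁ => ?_⟩
  -- The comparison goes through `e`, the only extension known to miss exactly one chamber.
  have h₀ : ChambersMissing.Compatible e e₀ :=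
    ChambersMissing.compatible hconn hbd hK hK₀ hn
  have h₁ : ChambersMissing.Compatible e e₁ :=
    ChambersMissing.compatible hconn hbd hK hK₁ hn
  exact (h₀.symm.trans h₁).exists_iso hconn hK₀ hK₁
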